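/- Let $H$ be a separable complex Hilbert space. For a bounded operator $T$ on $H$ and $k=0,1,2,\dots$ let $$\mu(k,T)=\inf\{t\ge 0:\ \mathrm{Tr}\,E_{|T|}(t,\infty)\le k\}$$ be its singular values, where $E_{|T|}$ is the spectral measure of $|T|=(T^*T)^{1/2}$ (for compact $T$ these are the eigenvalues of $|T|$ in descending order, counted with multiplicity). For $0<q<\infty$ let $$\mathcal{L}_{q,\infty}=\{T:\ \mu(k,T)=O((k+1)^{-1/q})\},\qquad \|T\|_{q,\infty}=\sup_{k\ge 0}(k+1)^{1/q}\mu(k,T),$$ and let $(\mathcal{L}_{q,\infty})_0$ be the separable part of $\mathcal{L}_{q,\infty}$, that is, the closure of the finite rank operators in $\mathcal{L}_{q,\infty}$ with respect to the quasi-norm $\|\cdot\|_{q,\infty}$. Let $1<p<\infty$, let $A\ge 0$ be a bounded operator on $H$ and let $0\le B\in\mathcal{L}_{p,\infty}$. If $[A^{1/2},B]=A^{1/2}B-BA^{1/2}\in(\mathcal{L}_{p,\infty})_0$, then $$B^pA^p-(A^{1/2}BA^{1/2})^p\in(\mathcal{L}_{1,\infty})_0.$$ -/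

import Mathlib

noncomputable section

variable {H : Type*} [NormedAddCommGroup H] [InnerProductSpace ℂ H] [CompleteSpace H]

/-- The counting function `n_{|T|}(t) = Tr E_{|T|}(t, ∞)` of a bounded operator `T`, for `t ≥ 0`:
the number of eigenvalues of `|T|` greater than `t`, counted with multiplicity, when `T` is compact.
The range of the operator `(|T| - t)⁺` (functional calculus of `x ↦ max (x - t) 0`) is
dense in the range of the spectral projection `E_{|T|}(t, ∞)`, so that the rank of the former
is the trace of the latter (`⊤` if infinite). -/
def spectralCount (T : H →L[ℂ] H) (t : ℝ) : ℕ∞ :=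
  Cardinal.toENat (LinearMap.rank (cfc (fun x : ℝ => max (x - t) 0) (CFC.abs T)).toLinearMap)

/-- The singular value `μ(k, T) = inf {t ≥ 0 : n_{|T|}(t) ≤ k}`, `k = 0, 1, 2, …`. For compact `T`
these are the eigenvalues of `|T|` in descending order, counted with multiplicity. -/
def singularValue (T : H →L[ℂ] H) (k : ℕ) : ℝ :=
  sInf {t : ℝ | 0 ≤ t ∧ spectralCount T t ≤ k}

/-- `T ∈ 𝓛_{p,∞}`: `μ(k, T) = O((k+1)^{-1/p})`. -/
def MemWeakSchatten (p : ℝ) (T : H →L[ℂ] H) : Prop :=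
  (fun k : ℕ => singularValue T k) =O[Filter.atTop] fun k : ℕ => ((k : ℝ) + 1) ^ (-(1 / p))

/-- The quasi-norm `‖T‖_{p,∞} = sup_k (k+1)^{1/p} μ(k, T)`, with values in `[0, ∞]`. -/
def weakSchattenQuasiNorm (p : ℝ) (T : H →L[ℂ] H) : ENNReal :=
  ⨆ k : ℕ, ENNReal.ofReal (((k : ℝ) + 1) ^ (1 / p) * singularValue T k)

/-- `T ∈ (𝓛_{p,∞})₀`, the separable part of `𝓛_{p,∞}`: the closure in `𝓛_{p,∞}`, for its
quasi-norm, of the finite rank operators. -/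
def MemWeakSchattenSep (p : ℝ) (T : H →L[ℂ] H) : Prop :=
  MemWeakSchatten p T ∧
    ∀ ε : ENNReal, 0 < ε → ∃ F : H →L[ℂ] H,
      FiniteDimensional ℂ F.range ∧ weakSchattenQuasiNorm p (T - F) < ε

end

/-! Put α = 1/p < 1 and X = A^{1/2} B A^{1/2}. Call an operator negligible of order β if its
singular values are o(k^{-β}); for β = 1/q this is membership in the separable part of 𝓛_{q,∞}
(`memWeakSchattenSep_iff`). Orders add under products with operators whose singular values are
O(k^{-γ}). The hypothesis makes X - BA = [A^{1/2}, B] A^{1/2} negligible of order α. It suffices to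
pass to exponents θ < 1: if X^θ - B^θ A^θ and all [A^s, B^θ] are negligible of order αθ, where θ =
p/(m+1), then multiplying m+1 copies and moving powers of A past B^θ gives X^p - B^p A^p, of order
αp = 1.

Commutators (`negl_commutator_rpow_rpow`): the power S ↦ S^θ on positive operators is continuous for
the weak quasi-norms (`weakDecay_rpow_sub_rpow`). For unitary u this is applied to uBu* and B; a
self-adjoint contraction is the real part of a unitary in the closed *-algebra it generates.
Continuity rests on Hansen's inequality, Douglas' factorization, and a bound of S - T by the square
root of S² - T² (`WeakDecay.sub_of_mul_self_sub`), proved by Ky Fan sums, which is where orders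
below 1 matter.

Powers of X (`negl_rpow_sub`): the same square-root bound halves exponents, and products give all
dyadic exponents in (0, 1). For general θ take a dyadic s slightly below θ and η = θ - s. If A is
invertible, X is a negligible perturbation of B^{1/2} A B^{1/2}, which lies between multiples K⁻¹B
and KB; hence X^η is close to B^η up to a factor K^η - 1 that tends to 0 with η. Finally A + e
replaces A, and e → 0. -/

open Filter Topology
set_option linter.unusedSectionVars false
noncomputable section

variable {H : Type*} [NormedAddCommGroup H] [InnerProductSpace ℂ H] [CompleteSpace H]

/-! ### Operators bounded off finite-dimensional subspaces -/

/-- `T` has norm at most `t` on the orthogonal complement of a subspace of dimension at most `d`. -/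
def BoundedOff (T : H →L[ℂ] H) (d t : ℝ) : Prop :=
  ∃ V : Submodule ℂ H, FiniteDimensional ℂ V ∧ (Module.finrank ℂ V : ℝ) ≤ d ∧
    ∀ x ∈ Vᗮ, ‖T x‖ ≤ t * ‖x‖

namespace BoundedOff

variable {S T A : H →L[ℂ] H} {d d' t t' : ℝ}

theorem mono (h : BoundedOff T d t) (hd : d ≤ d') (ht : t ≤ t') : BoundedOff T d' t' := by
  obtain ⟨V, hV, hVd, hVt⟩ := h
  exact ⟨V, hV, hVd.trans hd, fun x hx => (hVt x hx).trans (by gcongr)⟩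

theorem of_norm_le (hd : 0 ≤ d) (h : ‖T‖ ≤ t) : BoundedOff T d t :=
  ⟨⊥, inferInstance, by simpa using hd, fun x _ => T.le_of_opNorm_le h x⟩

theorem finrank_sup_le {V W : Submodule ℂ H} [FiniteDimensional ℂ V] [FiniteDimensional ℂ W]
    (hV : (Module.finrank ℂ V : ℝ) ≤ d) (hW : (Module.finrank ℂ W : ℝ) ≤ d') :
    (Module.finrank ℂ (V ⊔ W : Submodule ℂ H) : ℝ) ≤ d + d' := by
  have := Submodule.finrank_add_le_finrank_add_finrank V W
  have h2 : (Module.finrank ℂ (V ⊔ W : Submodule ℂ H) : ℝ) ≤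
    Module.finrank ℂ V + Module.finrank ℂ W := by exact_mod_cast this
  linarith

theorem finrank_map_le (A : H →L[ℂ] H) {V : Submodule ℂ H} [FiniteDimensional ℂ V]
    (hV : (Module.finrank ℂ V : ℝ) ≤ d) :
    (Module.finrank ℂ (V.map A.toLinearMap) : ℝ) ≤ d := by
  have := Submodule.finrank_map_le A.toLinearMap V
  exact le_trans (by exact_mod_cast this) hV

theorem mem_orthogonal_of_map_adjoint (A : H →L[ℂ] H) {V : Submodule ℂ H} {x : H}
    (hx : x ∈ (V.map (ContinuousLinearMap.adjoint A).toLinearMap)ᗮ) : A x ∈ Vᗮ := by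
  rw [Submodule.mem_orthogonal] at hx ⊢
  intro u hu
  have := hx _ (Submodule.mem_map_of_mem hu)
  simpa [ContinuousLinearMap.adjoint_inner_left] using this

theorem add (hS : BoundedOff S d t) (hT : BoundedOff T d' t') :
    BoundedOff (S + T) (d + d') (t + t') := by
  obtain ⟨V, hV, hVd, hVt⟩ := hS
  obtain ⟨W, hW, hWd, hWt⟩ := hT
  refine ⟨V ⊔ W, inferInstance, finrank_sup_le hVd hWd, fun x hx => ?_⟩
  rw [← Submodule.inf_orthogonal] at hx
  calc ‖S x + T x‖ ≤ ‖S x‖ + ‖T x‖ := norm_add_le _ _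
    _ ≤ t * ‖x‖ + t' * ‖x‖ := add_le_add (hVt x hx.1) (hWt x hx.2)
    _ = _ := by ring

/-- The exceptional space V of S is pulled back to T*V: T x is orthogonal to V as soon as x is
orthogonal to T*V, and the dimension does not grow. -/
theorem comp (hS : BoundedOff S d t) (hT : BoundedOff T d' t') (ht : 0 ≤ t) :
    BoundedOff (S * T) (d + d') (t * t') := by
  obtain ⟨V, hV, hVd, hVt⟩ := hS
  obtain ⟨W, hW, hWd, hWt⟩ := hT
  refine ⟨V.map (ContinuousLinearMap.adjoint T).toLinearMap ⊔ W, inferInstance,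
    finrank_sup_le (finrank_map_le _ hVd) hWd, fun x hx => ?_⟩
  rw [← Submodule.inf_orthogonal] at hx
  calc ‖S (T x)‖ ≤ t * ‖T x‖ := hVt _ (mem_orthogonal_of_map_adjoint T hx.1)
    _ ≤ t * (t' * ‖x‖) := by gcongr; exact hWt x hx.2
    _ = _ := by ring

theorem mul_left (hT : BoundedOff T d t) (A : H →L[ℂ] H) : BoundedOff (A * T) d (‖A‖ * t) := by
  have := comp (of_norm_le le_rfl le_rfl : BoundedOff A 0 ‖A‖) hT (norm_nonneg A)
  simpa using this

theorem mul_right (hT : BoundedOff T d t) (A : H →L[ℂ] H) (ht : 0 ≤ t) :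
    BoundedOff (T * A) d (t * ‖A‖) := by
  have := comp hT (of_norm_le le_rfl le_rfl : BoundedOff A 0 ‖A‖) ht
  simpa using this

theorem neg (hT : BoundedOff T d t) : BoundedOff (-T) d t := by
  obtain ⟨V, hV, hVd, hVt⟩ := hT
  exact ⟨V, hV, hVd, fun x hx => by simpa using hVt x hx⟩

theorem congr_norm (hT : BoundedOff T d t) (h : ∀ x, ‖S x‖ = ‖T x‖) : BoundedOff S d t := by
  obtain ⟨V, hV, hVd, hVt⟩ := hT
  exact ⟨V, hV, hVd, fun x hx => (h x).le.trans (hVt x hx)⟩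

/-- The compression to the complement of the exceptional subspace. -/
theorem norm_sub_comp_le {V : Submodule ℂ H} [V.HasOrthogonalProjection]
    (hVt : ∀ x ∈ Vᗮ, ‖T x‖ ≤ t * ‖x‖) (ht : 0 ≤ t) : ‖T - T * V.starProjection‖ ≤ t := by
  refine ContinuousLinearMap.opNorm_le_bound _ ht fun x => ?_
  have h1 : (T - T * V.starProjection) x = T (x - V.starProjection x) := by simp
  rw [h1]
  refine (hVt _ (V.sub_starProjection_mem_orthogonal x)).trans ?_
  gcongr
  have h2 := V.norm_sq_eq_add_norm_sq_starProjection x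
  have h3 : Vᗮ.starProjection x = x - V.starProjection x := by
    simp [Submodule.starProjection_orthogonal]
  rw [h3] at h2
  nlinarith [norm_nonneg x, norm_nonneg (x - V.starProjection x), sq_nonneg ‖V.starProjection x‖]

/-- With P the projection onto V, T - TP has norm at most t. Its adjoint T* - PT* agrees with T* on
the complement of T(V), where PT* vanishes. -/
theorem adjoint (hT : BoundedOff T d t) (ht : 0 ≤ t) : BoundedOff (star T) d t := by
  obtain ⟨V, hV, hVd, hVt⟩ := hT
  have key := norm_sub_comp_le hVt ht
  refine ⟨V.map T.toLinearMap, inferInstance, finrank_map_le T hVd, fun x hx => ?_⟩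
  have h0 : V.starProjection (star T x) = 0 := by
    rw [Submodule.starProjection_apply_eq_zero_iff]
    have := mem_orthogonal_of_map_adjoint (star T) (V := V) (x := x)
      (by rwa [← ContinuousLinearMap.star_eq_adjoint, star_star])
    exact this
  have h1 : star (T - T * V.starProjection) x = star T x := by
    rw [star_sub, star_mul, (isSelfAdjoint_starProjection V).star_eq]
    simp [h0]
  rw [← h1]
  exact ContinuousLinearMap.le_of_opNorm_le _ (by rwa [norm_star]) x

/-- The square of `T` is bounded off a subspace if and only if the form of `T* T` is. -/
theorem of_star_mul_self (hT : BoundedOff (star T * T) d (t ^ 2)) (ht : 0 ≤ t) :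
    BoundedOff T d t := by
  obtain ⟨V, hV, hVd, hVt⟩ := hT
  refine ⟨V, hV, hVd, fun x hx => ?_⟩
  have h1 : ‖T x‖ ^ 2 = RCLike.re (inner ℂ ((star T * T) x) x) := by
    rw [mul_apply_eq_comp, ContinuousLinearMap.star_eq_adjoint,
      ContinuousLinearMap.adjoint_inner_left, inner_self_eq_norm_sq]
  have h2 : ‖T x‖ ^ 2 ≤ (t * ‖x‖) ^ 2 := by
    rw [h1]
    calc _ ≤ ‖(star T * T) x‖ * ‖x‖ := re_inner_le_norm _ _
      _ ≤ (t ^ 2 * ‖x‖) * ‖x‖ := by gcongr; exact hVt x hx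
      _ = _ := by ring
  exact le_of_sq_le_sq h2 (by positivity)

end BoundedOff

/-! ### Quadratic forms and fractional powers -/

/-- The quadratic form of `S` is at most `t` off a subspace of dimension at most `d`. -/
def FormBoundedOff (S : H →L[ℂ] H) (d t : ℝ) : Prop :=
  ∃ V : Submodule ℂ H, FiniteDimensional ℂ V ∧ (Module.finrank ℂ V : ℝ) ≤ d ∧
    ∀ x ∈ Vᗮ, RCLike.re (inner ℂ (S x) x) ≤ t * ‖x‖ ^ 2

section
variable {S T A : H →L[ℂ] H} {d d' t t' : ℝ}

theorem re_inner_le_of_le (h : S ≤ T) (x : H) :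
    RCLike.re (inner ℂ (S x) x) ≤ RCLike.re (inner ℂ (T x) x) := by
  have := ((ContinuousLinearMap.le_def _ _).1 h).re_inner_nonneg_left x
  rw [sub_apply, inner_sub_left, map_sub] at this
  linarith

theorem re_inner_nonneg (h : 0 ≤ S) (x : H) : 0 ≤ RCLike.re (inner ℂ (S x) x) := by
  simpa using re_inner_le_of_le h x

theorem le_of_re_inner_le (hS : IsSelfAdjoint S) (hT : IsSelfAdjoint T)
    (h : ∀ x, RCLike.re (inner ℂ (S x) x) ≤ RCLike.re (inner ℂ (T x) x)) : S ≤ T := by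
  rw [ContinuousLinearMap.le_def, ContinuousLinearMap.isPositive_def']
  refine ⟨hT.sub hS, fun x => ?_⟩
  rw [ContinuousLinearMap.reApplyInnerSelf_apply, sub_apply, inner_sub_left,
    map_sub]
  linarith [h x]

theorem re_inner_star_mul_self (T : H →L[ℂ] H) (x : H) :
    RCLike.re (inner ℂ ((star T * T) x) x) = ‖T x‖ ^ 2 := by
  rw [mul_apply_eq_comp, ContinuousLinearMap.star_eq_adjoint,
      ContinuousLinearMap.adjoint_inner_left, inner_self_eq_norm_sq]

theorem norm_sqrt_apply_sq (hS : 0 ≤ S) (x : H) :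
    ‖CFC.sqrt S x‖ ^ 2 = RCLike.re (inner ℂ (S x) x) := by
  rw [← re_inner_star_mul_self, (IsSelfAdjoint.of_nonneg (CFC.sqrt_nonneg S)).star_eq,
    CFC.sqrt_mul_sqrt_self S hS]

theorem norm_abs_apply (T : H →L[ℂ] H) (x : H) : ‖CFC.abs T x‖ = ‖T x‖ := by
  rw [← sq_eq_sq₀ (norm_nonneg _) (norm_nonneg _), ← re_inner_star_mul_self,
    ← re_inner_star_mul_self, (IsSelfAdjoint.of_nonneg (CFC.abs_nonneg T)).star_eq,
    CFC.abs_mul_abs]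

theorem BoundedOff.form (h : BoundedOff S d t) : FormBoundedOff S d t := by
  obtain ⟨V, hV, hVd, hVt⟩ := h
  refine ⟨V, hV, hVd, fun x hx => ?_⟩
  calc _ ≤ ‖S x‖ * ‖x‖ := re_inner_le_norm _ _
    _ ≤ (t * ‖x‖) * ‖x‖ := by gcongr; exact hVt x hx
    _ = _ := by ring

theorem BoundedOff.abs (h : BoundedOff T d t) : BoundedOff (CFC.abs T) d t :=
  h.congr_norm (norm_abs_apply T)

namespace FormBoundedOff

theorem of_le (hT : FormBoundedOff T d t) (h : S ≤ T) : FormBoundedOff S d t := by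
  obtain ⟨V, hV, hVd, hVt⟩ := hT
  exact ⟨V, hV, hVd, fun x hx => (re_inner_le_of_le h x).trans (hVt x hx)⟩

theorem boundedOff_of_star_mul_self (hT : FormBoundedOff (star T * T) d (t ^ 2)) (ht : 0 ≤ t) :
    BoundedOff T d t := by
  obtain ⟨V, hV, hVd, hVt⟩ := hT
  refine ⟨V, hV, hVd, fun x hx => le_of_sq_le_sq ?_ (by positivity)⟩
  rw [← re_inner_star_mul_self, mul_pow]
  exact hVt x hx

/-- A form bound t on S is a norm bound √t on S^{1/2}; composing S^{1/2} with itself costs the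
exceptional dimension twice. -/
theorem boundedOff (hS : 0 ≤ S) (h : FormBoundedOff S d t) (ht : 0 ≤ t) :
    BoundedOff S (2 * d) t := by
  have h1 : BoundedOff (CFC.sqrt S) d (√t) := by
    refine boundedOff_of_star_mul_self ?_ (Real.sqrt_nonneg t)
    rwa [(IsSelfAdjoint.of_nonneg (CFC.sqrt_nonneg S)).star_eq, CFC.sqrt_mul_sqrt_self S hS,
      Real.sq_sqrt ht]
  have := h1.comp h1 (Real.sqrt_nonneg t)
  rwa [CFC.sqrt_mul_sqrt_self S hS, Real.mul_self_sqrt ht, ← two_mul] at this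

end FormBoundedOff

theorem spectrum_nonneg (hS : 0 ≤ S) {x : ℝ} (hx : x ∈ spectrum ℝ S) : 0 ≤ x :=
  spectrum_nonneg_of_nonneg hS hx

/-- The concave function x^θ lies below its tangent at t. An affine bound in S transfers form bounds
to S^θ although the exceptional space need not be invariant under S. -/
theorem rpow_le_tangent (hS : 0 ≤ S) {θ : ℝ} (h0 : 0 < θ) (h1 : θ ≤ 1) (ht : 0 < t) :
    S ^ θ ≤ (θ * t ^ (θ - 1)) • S + ((1 - θ) * t ^ θ) • (1 : H →L[ℂ] H) := by
  have hr : (θ * t ^ (θ - 1)) • S + ((1 - θ) * t ^ θ) • (1 : H →L[ℂ] H) =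
      cfc (fun x : ℝ => (θ * t ^ (θ - 1)) * x + (1 - θ) * t ^ θ) S := by
    rw [cfc_add .., cfc_const_mul_id .., cfc_const ..]
    simp [Algebra.algebraMap_eq_smul_one]
  rw [hr, CFC.rpow_eq_cfc_real hS]
  refine cfc_mono (fun x hx => ?_)
    (hf := (Real.continuous_rpow_const h0.le).continuousOn)
  have hx0 := spectrum_nonneg hS hx
  have := Real.geom_mean_le_arith_mean2_weighted h0.le (sub_nonneg.2 h1) hx0 ht.le (by ring)
  have ht2 : t ^ (1 - θ) * t ^ (θ - 1) = 1 := by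
    rw [← Real.rpow_add ht]; simp
  have ht3 : t * t ^ (θ - 1) = t ^ θ := by
    rw [← Real.rpow_one_add' ht.le (by linarith)]; ring_nf
  calc x ^ θ = (x ^ θ * t ^ (1 - θ)) * t ^ (θ - 1) := by rw [mul_assoc, ht2, mul_one]
    _ ≤ (θ * x + (1 - θ) * t) * t ^ (θ - 1) := by gcongr
    _ = θ * t ^ (θ - 1) * x + (1 - θ) * (t * t ^ (θ - 1)) := by ring
    _ = _ := by rw [ht3]

theorem FormBoundedOff.rpow (hS : 0 ≤ S) (h : FormBoundedOff S d t) {θ : ℝ} (h0 : 0 < θ)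
    (h1 : θ ≤ 1) (ht : 0 < t) : FormBoundedOff (S ^ θ) d (t ^ θ) := by
  obtain ⟨V, hV, hVd, hVt⟩ := h
  refine ⟨V, hV, hVd, fun x hx => (re_inner_le_of_le (rpow_le_tangent hS h0 h1 ht) x).trans ?_⟩
  have e : RCLike.re (inner ℂ (((θ * t ^ (θ - 1)) • S + ((1 - θ) * t ^ θ) • (1 : H →L[ℂ] H)) x) x)
      = (θ * t ^ (θ - 1)) * RCLike.re (inner ℂ (S x) x) + ((1 - θ) * t ^ θ) * ‖x‖ ^ 2 := by
    rw [add_apply, inner_add_left, map_add, smul_apply,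
      smul_apply, inner_smul_left_eq_smul, inner_smul_left_eq_smul,
      RCLike.smul_re, RCLike.smul_re, one_apply_eq_self, inner_self_eq_norm_sq]
  have ht3 : t * t ^ (θ - 1) = t ^ θ := by
    rw [← Real.rpow_one_add' ht.le (by linarith)]; ring_nf
  rw [e]
  have h2 : 0 ≤ θ * t ^ (θ - 1) := by positivity
  calc _ ≤ (θ * t ^ (θ - 1)) * (t * ‖x‖ ^ 2) + ((1 - θ) * t ^ θ) * ‖x‖ ^ 2 := by
        gcongr; exact hVt x hx
    _ = θ * (t * t ^ (θ - 1)) * ‖x‖ ^ 2 + ((1 - θ) * t ^ θ) * ‖x‖ ^ 2 := by ring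
    _ = _ := by rw [ht3]; ring

/-! ### Spectral tails and singular values -/

/-- The operator `(T - t)⁺`. -/
def posTail (T : H →L[ℂ] H) (t : ℝ) : H →L[ℂ] H := cfc (fun x : ℝ => max (x - t) 0) T

theorem isSelfAdjoint_posTail (T : H →L[ℂ] H) (t : ℝ) : IsSelfAdjoint (posTail T t) :=
  cfc_predicate _ _

theorem norm_apply_le_of_posTail_eq_zero (hS : 0 ≤ S) (ht : 0 ≤ t) {x : H}
    (hx : posTail S t x = 0) : ‖S x‖ ≤ t * ‖x‖ := by
  have h1 : S = cfc (fun x : ℝ => min x t) S + posTail S t := by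
    rw [posTail, ← cfc_add ..]
    conv_lhs => rw [← cfc_id ℝ S]
    refine cfc_congr fun x _ => ?_
    rcases le_total x t with h | h <;> simp [h]
  have h2 : ‖cfc (fun x : ℝ => min x t) S‖ ≤ t := by
    refine norm_cfc_le ht fun x hx => ?_
    have := spectrum_nonneg hS hx
    rw [Real.norm_of_nonneg (le_min this ht)]
    exact min_le_right _ _
  rw [h1, add_apply, hx, add_zero]
  exact ContinuousLinearMap.le_of_opNorm_le _ h2 x

theorem le_norm_apply_of_mem_range_posTail (hS : 0 ≤ S) (ht : 0 ≤ t) {x : H}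
    (hx : x ∈ (posTail S t).toLinearMap.range) : t * ‖x‖ ≤ ‖S x‖ := by
  rcases ht.eq_or_lt with rfl | ht
  · simp
  obtain ⟨y, rfl⟩ := hx
  have hc : Continuous (fun x : ℝ => (max x t)⁻¹) :=
    (continuous_id.max continuous_const).inv₀ fun x => (lt_max_of_lt_right ht).ne'
  -- On the range of the tail, (max x t)⁻¹ of S inverts S, and its norm is at most 1/t.
  have h1 : posTail S t = cfc (fun x : ℝ => (max x t)⁻¹) S * (S * posTail S t) := by
    have e : S * posTail S t = cfc (fun x : ℝ => x * max (x - t) 0) S := by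
      rw [cfc_mul .., cfc_id' ℝ S]; rfl
    rw [e, ← cfc_mul _ _ _ (hc.continuousOn)]
    refine cfc_congr fun x _ => ?_
    rcases le_or_gt x t with h | h
    · simp [h]
    · have : x ≠ 0 := by linarith
      simp [h.le, this]
  have h2 : ‖cfc (fun x : ℝ => (max x t)⁻¹) S‖ ≤ t⁻¹ := by
    refine norm_cfc_le (by positivity) fun x hx => ?_
    rw [Real.norm_of_nonneg (by positivity)]
    exact inv_anti₀ ht (le_max_right _ _)
  have h3 := ContinuousLinearMap.le_of_opNorm_le _ h2 (S (posTail S t y))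
  have h4 : cfc (fun x : ℝ => (max x t)⁻¹) S (S (posTail S t y)) = posTail S t y := by
    conv_rhs => rw [h1]
    rfl
  rw [h4] at h3
  change t * ‖posTail S t y‖ ≤ ‖S (posTail S t y)‖
  rwa [inv_mul_eq_div, le_div_iff₀' ht] at h3

/-- The kernel of a self-adjoint operator is the complement of the range. -/
theorem apply_eq_zero_of_mem_range_orthogonal (hS : IsSelfAdjoint S) {x : H}
    (hx : x ∈ S.toLinearMap.rangeᗮ) : S x = 0 := by
  rw [Submodule.mem_orthogonal] at hx
  have := hx (S (S x)) ⟨_, rfl⟩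
  have h2 : inner ℂ (S (S x)) x = inner ℂ (S x) (S x) := by
    conv_lhs => rw [← hS.star_eq, ContinuousLinearMap.star_eq_adjoint]
    rw [ContinuousLinearMap.adjoint_inner_left]
    rw [← ContinuousLinearMap.star_eq_adjoint, hS.star_eq]
  rw [h2] at this
  exact inner_self_eq_zero.1 this

theorem boundedOff_of_spectralCount_le {k : ℕ} (ht : 0 ≤ t) (h : spectralCount T t ≤ k) :
    BoundedOff T k t := by
  have h1 : LinearMap.rank (posTail (CFC.abs T) t).toLinearMap ≤ (k : Cardinal) := by
    have : Cardinal.toENat (LinearMap.rank (posTail (CFC.abs T) t).toLinearMap) ≤ (k : ℕ∞) := h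
    simpa using Cardinal.toENat_le_natCast.1 this
  have hfd : FiniteDimensional ℂ (posTail (CFC.abs T) t).toLinearMap.range :=
    Module.rank_lt_aleph0_iff.1 (h1.trans_lt (Cardinal.natCast_lt_aleph0))
  refine ⟨(posTail (CFC.abs T) t).toLinearMap.range, hfd, ?_, fun x hx => ?_⟩
  · have := Module.finrank_le_of_rank_le h1
    exact_mod_cast this
  · rw [← norm_abs_apply]
    exact norm_apply_le_of_posTail_eq_zero (CFC.abs_nonneg T) ht
      (apply_eq_zero_of_mem_range_orthogonal (isSelfAdjoint_posTail _ _) hx)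

/-- A subspace on which `T` is bounded below by more than `t` has dimension at most `d`. -/
theorem BoundedOff.rank_le {k : ℕ} (h : BoundedOff T k t) (htt : t < t') {W : Submodule ℂ H}
    (hW : ∀ x ∈ W, t' * ‖x‖ ≤ ‖T x‖) : Module.rank ℂ W ≤ (k : Cardinal) := by
  obtain ⟨V, hV, hVd, hVt⟩ := h
  let f : W →ₗ[ℂ] V := V.orthogonalProjectionOnto.toLinearMap ∘ₗ W.subtype
  have hf : Function.Injective f := by
    rw [← LinearMap.ker_eq_bot, LinearMap.ker_eq_bot']
    intro x hx
    have hx' : (x : H) ∈ Vᗮ := by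
      rw [← Submodule.orthogonalProjectionOnto_eq_zero_iff]; exact hx
    have h1 := hVt _ hx'
    have h2 := hW x x.2
    have h3 : ‖(x : H)‖ = 0 := by nlinarith [norm_nonneg (x : H)]
    simpa using h3
  have h1 := LinearMap.rank_le_of_injective f hf
  refine h1.trans ?_
  rw [← Module.finrank_eq_rank]
  exact_mod_cast hVd

theorem spectralCount_le_of_boundedOff {k : ℕ} (h : BoundedOff T k t) (htt : t < t') (ht' : 0 ≤ t') :
    spectralCount T t' ≤ k := by
  have h1 : Module.rank ℂ (posTail (CFC.abs T) t').toLinearMap.range ≤ (k : Cardinal) :=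
    h.rank_le htt fun x hx => by
      rw [← norm_abs_apply]
      exact le_norm_apply_of_mem_range_posTail (CFC.abs_nonneg T) ht' hx
  exact Cardinal.toENat_le_natCast.2 h1

theorem singularValue_le_of_boundedOff {k : ℕ} (h : BoundedOff T k t) (ht : 0 ≤ t) :
    singularValue T k ≤ t := by
  refine le_of_forall_gt_imp_ge_of_dense fun t' htt => ?_
  exact csInf_le ⟨0, fun s hs => hs.1⟩
    ⟨ht.trans htt.le, spectralCount_le_of_boundedOff h htt (ht.trans htt.le)⟩

theorem boundedOff_of_singularValue_lt {k : ℕ} (h : singularValue T k < t) :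
    BoundedOff T k t := by
  have hne : {t : ℝ | 0 ≤ t ∧ spectralCount T t ≤ k}.Nonempty := by
    refine ⟨‖T‖ + 1, by positivity, ?_⟩
    exact spectralCount_le_of_boundedOff (BoundedOff.of_norm_le (by positivity) le_rfl)
      (lt_add_one _) (by positivity)
  obtain ⟨s, hs, hst⟩ := exists_lt_of_csInf_lt hne h
  exact (boundedOff_of_spectralCount_le hs.1 hs.2).mono le_rfl hst.le

theorem singularValue_nonneg (T : H →L[ℂ] H) (k : ℕ) : 0 ≤ singularValue T k :=
  Real.sInf_nonneg fun _ hs => hs.1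

end

/-! ### Calculus of singular value asymptotics -/

/-- For all large `x`, the operator `T` is bounded by `C x ^ (-α)` off a subspace of dimension at
most `x`; that is, the singular values of `T` satisfy `limsup k ^ α μ(k, T) ≤ C`. -/
def WeakDecay (α C : ℝ) (T : H →L[ℂ] H) : Prop :=
  ∀ᶠ x : ℝ in atTop, BoundedOff T x (C * x ^ (-α))

/-- The singular values of `T` are `O(k ^ (-α))`. -/
def WeakBdd (α : ℝ) (T : H →L[ℂ] H) : Prop := ∃ C > 0, WeakDecay α C T

/-- The singular values of `T` are `o(k ^ (-α))`. -/
def Negl (α : ℝ) (T : H →L[ℂ] H) : Prop := ∀ C > 0, WeakDecay α C T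

section
variable {S T R : H →L[ℂ] H} {α β C D θ : ℝ}

theorem half_rpow_neg {x : ℝ} (hx : 0 < x) (α : ℝ) : (x / 2) ^ (-α) = 2 ^ α * x ^ (-α) := by
  rw [div_eq_mul_inv, Real.mul_rpow hx.le (by norm_num), Real.inv_rpow (by norm_num),
    Real.rpow_neg (by norm_num : (0 : ℝ) ≤ 2), inv_inv, mul_comm]

namespace WeakDecay

theorem mono (h : WeakDecay α C T) (hC : C ≤ D) : WeakDecay α D T := by
  filter_upwards [h, eventually_gt_atTop 0] with x hx h0
  exact hx.mono le_rfl (by gcongr)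

/-- Sums and products split the dimension x evenly between two operators; this is the source of the
factors 2^α. -/
theorem half (h : WeakDecay α C T) :
    ∀ᶠ x : ℝ in atTop, BoundedOff T (x / 2) (2 ^ α * C * x ^ (-α)) := by
  have : Tendsto (fun x : ℝ => x / 2) atTop atTop := tendsto_id.atTop_div_const (by norm_num)
  filter_upwards [this.eventually h, eventually_gt_atTop 0] with x hx h0
  rw [half_rpow_neg h0] at hx
  convert hx using 1
  ring

theorem of_half (h : ∀ᶠ x : ℝ in atTop, BoundedOff T (2 * x) (C * x ^ (-α))) :
    WeakDecay α (2 ^ α * C) T := by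
  have : Tendsto (fun x : ℝ => x / 2) atTop atTop := tendsto_id.atTop_div_const (by norm_num)
  filter_upwards [this.eventually h, eventually_gt_atTop 0] with x hx h0
  rw [half_rpow_neg h0] at hx
  convert hx using 1 <;> ring

theorem add (hS : WeakDecay α C S) (hT : WeakDecay α D T) :
    WeakDecay α (2 ^ α * (C + D)) (S + T) := by
  filter_upwards [hS.half, hT.half] with x h1 h2
  convert h1.add h2 using 1 <;> ring

theorem mul (hS : WeakDecay α C S) (hT : WeakDecay β D T) (hC : 0 ≤ C) :
    WeakDecay (α + β) (2 ^ (α + β) * (C * D)) (S * T) := by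
  filter_upwards [hS.half, hT.half, eventually_gt_atTop 0] with x h1 h2 h0
  convert h1.comp h2 (by positivity) using 1
  · ring
  · rw [neg_add, Real.rpow_add h0, Real.rpow_add (by norm_num)]
    ring

theorem neg (hT : WeakDecay α C T) : WeakDecay α C (-T) := by
  filter_upwards [hT] with x h1 using h1.neg

theorem sub (hS : WeakDecay α C S) (hT : WeakDecay α D T) :
    WeakDecay α (2 ^ α * (C + D)) (S - T) := by
  rw [sub_eq_add_neg]; exact hS.add hT.neg

theorem mul_left (hT : WeakDecay α C T) (A : H →L[ℂ] H) : WeakDecay α (‖A‖ * C) (A * T) := by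
  filter_upwards [hT] with x h1
  convert h1.mul_left A using 1
  ring

theorem mul_right (hT : WeakDecay α C T) (hC : 0 ≤ C) (A : H →L[ℂ] H) :
    WeakDecay α (C * ‖A‖) (T * A) := by
  filter_upwards [hT, eventually_gt_atTop 0] with x h1 h0
  convert h1.mul_right A (by positivity) using 1
  ring

theorem star (hT : WeakDecay α C T) (hC : 0 ≤ C) : WeakDecay α C (star T) := by
  filter_upwards [hT, eventually_gt_atTop 0] with x h1 h0
  exact h1.adjoint (by positivity)

theorem abs (hT : WeakDecay α C T) : WeakDecay α C (CFC.abs T) := by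
  filter_upwards [hT] with x h1 using h1.abs

theorem smul (hT : WeakDecay α C T) (c : ℂ) : WeakDecay α (‖c‖ * C) (c • T) := by
  filter_upwards [hT, eventually_gt_atTop 0] with x ⟨V, hV, hVd, hVt⟩ h0
  refine ⟨V, hV, hVd, fun y hy => ?_⟩
  rw [smul_apply, norm_smul, mul_assoc, mul_assoc]
  gcongr
  rw [← mul_assoc]
  exact hVt y hy

theorem of_nonneg_of_le (hT : WeakDecay α C T) (hC : 0 ≤ C) (hS : 0 ≤ S) (hST : S ≤ T) :
    WeakDecay α (2 ^ α * C) S := by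
  refine of_half ?_
  filter_upwards [hT, eventually_gt_atTop 0] with x h1 h0
  exact FormBoundedOff.boundedOff hS (h1.form.of_le hST) (by positivity)

/-- Here 0 ≤ S + R ≤ 2R, so the positive case applies to S + R, and R is then subtracted. -/
theorem of_neg_le_of_le (hR : WeakDecay α C R) (hC : 0 ≤ C) (h1 : -R ≤ S) (h2 : S ≤ R) :
    WeakDecay α (2 ^ α * (2 ^ α * (2 ^ α * (C + C)) + C)) S := by
  have h3 : WeakDecay α (2 ^ α * (2 ^ α * (C + C))) (S + R) :=
    (hR.add hR).of_nonneg_of_le (by positivity) (neg_le_iff_add_nonneg.1 h1) (by gcongr)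
  simpa using h3.sub hR

theorem rpow (hS : 0 ≤ S) (h : WeakDecay α C S) (hC : 0 < C) (h0 : 0 < θ) (h1 : θ ≤ 1) :
    WeakDecay (α * θ) (2 ^ (α * θ) * C ^ θ) (S ^ θ) := by
  refine of_half ?_
  filter_upwards [h, eventually_gt_atTop 0] with x hx hx0
  have := (hx.form.rpow hS h0 h1 (by positivity)).boundedOff CFC.rpow_nonneg (by positivity)
  rw [Real.mul_rpow hC.le (by positivity), ← Real.rpow_mul hx0.le] at this
  convert this using 1
  ring_nf

theorem of_star_mul_self (h : WeakDecay (2 * α) (C ^ 2) (Star.star T * T)) (hC : 0 ≤ C) :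
    WeakDecay α C T := by
  filter_upwards [h, eventually_gt_atTop 0] with x hx hx0
  refine BoundedOff.of_star_mul_self ?_ (by positivity)
  convert hx using 1
  rw [mul_pow, ← Real.rpow_natCast (x ^ (-α)), ← Real.rpow_mul hx0.le]
  push_cast
  ring_nf

theorem of_eventually_singularValue_le (hα : 0 < α) (hC : 0 ≤ C)
    (h : ∀ᶠ k : ℕ in atTop, singularValue T k ≤ C * ((k : ℝ) + 1) ^ (-α)) (hCD : C < D) :
    WeakDecay α D T := by
  filter_upwards [(tendsto_nat_floor_atTop (α := ℝ)).eventually h, eventually_gt_atTop 0]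
    with x hx hx0
  -- Since ⌊x⌋ + 1 > x, the bound at index ⌊x⌋ is good enough at x. The slack C < D gives the strict
  -- inequality needed to pass from an infimum to an actual exceptional subspace.
  have h1 : singularValue T ⌊x⌋₊ < D * x ^ (-α) := by
    calc _ ≤ C * ((⌊x⌋₊ : ℝ) + 1) ^ (-α) := hx
      _ ≤ C * x ^ (-α) := by
        refine mul_le_mul_of_nonneg_left ?_ hC
        exact Real.rpow_le_rpow_of_nonpos hx0 (Nat.lt_floor_add_one x).le (by linarith)
      _ < _ := by gcongr
  exact (boundedOff_of_singularValue_lt h1).mono (Nat.floor_le hx0.le) le_rfl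

theorem eventually_singularValue_le (h : WeakDecay α C T) (hα : 0 < α) (hC : 0 ≤ C) :
    ∀ᶠ k : ℕ in atTop, singularValue T k ≤ 2 ^ α * C * ((k : ℝ) + 1) ^ (-α) := by
  filter_upwards [(tendsto_natCast_atTop_atTop (R := ℝ)).eventually h, eventually_ge_atTop 1]
    with k hk hk1
  have hk1' : (1 : ℝ) ≤ k := by exact_mod_cast hk1
  refine (singularValue_le_of_boundedOff hk (by positivity)).trans ?_
  rw [mul_comm (2 ^ α) C, mul_assoc, ← half_rpow_neg (by positivity)]
  gcongr ?_ * ?_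
  exact Real.rpow_le_rpow_of_nonpos (by positivity) (by linarith) (by linarith)

theorem of_finiteDimensional_range {F : H →L[ℂ] H} (hF : FiniteDimensional ℂ F.range)
    (hC : 0 ≤ C) : WeakDecay α C F := by
  -- F* vanishes on the complement of the range of F; the adjoint then carries this back to F.
  have h1 : BoundedOff (Star.star F) (Module.finrank ℂ F.range) 0 := by
    refine ⟨F.range, hF, le_rfl, fun x hx => ?_⟩
    have : Star.star F x = 0 := by
      refine ext_inner_left ℂ fun y => ?_
      rw [ContinuousLinearMap.star_eq_adjoint, ContinuousLinearMap.adjoint_inner_right,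
        inner_zero_right]
      exact (Submodule.mem_orthogonal _ _).1 hx _ ⟨y, rfl⟩
    simp [this]
  have h2 := h1.adjoint le_rfl
  rw [star_star] at h2
  filter_upwards [eventually_ge_atTop (Module.finrank ℂ F.range : ℝ), eventually_gt_atTop 0]
    with x hx hx0
  exact h2.mono hx (by positivity)

end WeakDecay

/-! ### Weak Schatten classes as asymptotic conditions -/

theorem memWeakSchatten_iff {p : ℝ} (hp : 0 < p) : MemWeakSchatten p T ↔ WeakBdd (1 / p) T := by
  have hα : 0 < 1 / p := by positivity
  constructor
  · intro h
    obtain ⟨C, hC, h⟩ := h.exists_pos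
    refine ⟨C + 1, by positivity, WeakDecay.of_eventually_singularValue_le hα hC.le ?_
      (lt_add_one C)⟩
    filter_upwards [h.bound] with k hk
    rwa [Real.norm_of_nonneg (singularValue_nonneg T k), Real.norm_of_nonneg (by positivity)] at hk
  · rintro ⟨C, hC, h⟩
    refine Asymptotics.IsBigO.of_bound (2 ^ (1 / p) * C) ?_
    filter_upwards [h.eventually_singularValue_le hα hC.le] with k hk
    rwa [Real.norm_of_nonneg (singularValue_nonneg T k), Real.norm_of_nonneg (by positivity)]

theorem Negl.weakBdd (h : Negl α T) : WeakBdd α T := ⟨1, one_pos, h 1 one_pos⟩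

/-- Take F = TP, with P the projection onto the exceptional space at a large index K. For j ≥ K, T -
F = T(1 - P) has singular values no larger than those of T; for j ≤ K its norm alone is small
enough. -/
theorem exists_finiteDimensional_singularValue_le (hα : 0 < α) (h : Negl α T) (hC : 0 < C) :
    ∃ F : H →L[ℂ] H, FiniteDimensional ℂ F.range ∧
      ∀ j : ℕ, ((j : ℝ) + 1) ^ α * singularValue (T - F) j ≤ C := by
  set c := C / 2 ^ α with hc
  have hc0 : 0 < c := by positivity
  have e1 := (h c hc0).eventually_singularValue_le hα hc0.le
  have e2 := (tendsto_natCast_atTop_atTop (R := ℝ)).eventually (h (c / 2) (by positivity))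
  have hcC : 2 ^ α * c = C := by rw [hc]; field_simp
  rw [hcC] at e1
  obtain ⟨K, hK⟩ := eventually_atTop.1 ((e1.and e2).and (eventually_ge_atTop 1))
  obtain ⟨⟨-, V, hV, hVd, hVt⟩, hK1⟩ := hK K le_rfl
  have hK1' : (1 : ℝ) ≤ K := by exact_mod_cast hK1
  have ht : c / 2 * (K : ℝ) ^ (-α) ≤ C * ((K : ℝ) + 1) ^ (-α) := by
    rw [← hcC, mul_comm (2 ^ α) c, mul_assoc, ← half_rpow_neg (by positivity)]
    gcongr ?_ * ?_
    · linarith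
    · exact Real.rpow_le_rpow_of_nonpos (by positivity) (by linarith) (by linarith)
  refine ⟨T * V.starProjection, ?_, fun j => ?_⟩
  · have : (T * V.starProjection).range ≤ V.map T.toLinearMap := by
      rintro _ ⟨x, rfl⟩
      exact ⟨V.starProjection x, V.starProjection_apply_mem x, rfl⟩
    exact Submodule.finiteDimensional_of_le this
  · suffices singularValue (T - T * V.starProjection) j ≤ C * ((j : ℝ) + 1) ^ (-α) by
      calc _ ≤ ((j : ℝ) + 1) ^ α * (C * ((j : ℝ) + 1) ^ (-α)) := by gcongr
        _ = C * (((j : ℝ) + 1) ^ α * ((j : ℝ) + 1) ^ (-α)) := by ring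
        _ = C := by rw [← Real.rpow_add (by positivity)]; simp
    rcases le_total K j with hj | hj
    · refine le_trans ?_ (hK j hj).1.1
      refine le_of_forall_gt_imp_ge_of_dense fun t ht => ?_
      have h1 := boundedOff_of_singularValue_lt ht
      have ht0 : 0 ≤ t := (singularValue_nonneg _ _).trans ht.le
      have h2 : T - T * V.starProjection = T * Vᗮ.starProjection := by
        rw [Submodule.starProjection_orthogonal, mul_sub]; rfl
      rw [h2]
      refine singularValue_le_of_boundedOff ((h1.mul_right _ ht0).mono le_rfl ?_) ht0
      exact mul_le_of_le_one_right ht0 (Submodule.starProjection_norm_le _)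
    · refine singularValue_le_of_boundedOff (BoundedOff.of_norm_le (by positivity) ?_)
        (by positivity)
      refine (BoundedOff.norm_sub_comp_le hVt (by positivity)).trans (ht.trans ?_)
      gcongr ?_ * ?_
      exact Real.rpow_le_rpow_of_nonpos (by positivity) (by gcongr) (by linarith)

theorem memWeakSchattenSep_iff {p : ℝ} (hp : 0 < p) :
    MemWeakSchattenSep p T ↔ Negl (1 / p) T := by
  have hα : 0 < 1 / p := by positivity
  constructor
  · rintro ⟨-, h⟩ C hC
    -- The last 2 pays for strictness in the passage to `WeakDecay`, and 2^{1/p} pays for adding F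
    -- back.
    set c := C / 2 ^ (1 / p) / 2 with hc
    have hc0 : 0 < c := by positivity
    obtain ⟨F, hF, hFT⟩ := h (ENNReal.ofReal c) (by simpa using hc0)
    have h1 : ∀ k : ℕ, singularValue (T - F) k ≤ c * ((k : ℝ) + 1) ^ (-(1 / p)) := fun k => by
      have h2 : ENNReal.ofReal (((k : ℝ) + 1) ^ (1 / p) * singularValue (T - F) k) <
          ENNReal.ofReal c :=
        lt_of_le_of_lt (le_iSup (fun k : ℕ =>
          ENNReal.ofReal (((k : ℝ) + 1) ^ (1 / p) * singularValue (T - F) k)) k) hFT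
      have h3 := ((ENNReal.ofReal_lt_ofReal_iff hc0).1 h2).le
      rw [Real.rpow_neg (by positivity), ← div_eq_mul_inv, le_div_iff₀' (by positivity)]
      exact h3
    have h4 : WeakDecay (1 / p) (2 * c) (T - F) :=
      WeakDecay.of_eventually_singularValue_le hα hc0.le (Eventually.of_forall h1) (by linarith)
    have h5 := h4.add (WeakDecay.of_finiteDimensional_range (α := 1 / p) hF (le_refl 0))
    rw [sub_add_cancel] at h5
    convert h5 using 1
    rw [hc]; field_simp; ring
  · intro h
    refine ⟨(memWeakSchatten_iff hp).2 h.weakBdd, fun ε hε => ?_⟩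
    obtain ⟨δ, hδ0, hδ⟩ := ENNReal.lt_iff_exists_real_btwn.1 hε
    have hδ1 : 0 < δ := by simpa using hδ.1
    obtain ⟨F, hF, hFT⟩ := exists_finiteDimensional_singularValue_le hα h hδ1
    exact ⟨F, hF, lt_of_le_of_lt (iSup_le fun k => ENNReal.ofReal_le_ofReal (hFT k)) hδ.2⟩

/-! ### Arithmetic of bounded and negligible operators -/

namespace WeakBdd

theorem add (hS : WeakBdd α S) (hT : WeakBdd α T) : WeakBdd α (S + T) := by
  obtain ⟨C, hC, hS⟩ := hS
  obtain ⟨D, hD, hT⟩ := hT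
  exact ⟨_, by positivity, hS.add hT⟩

theorem mul (hS : WeakBdd α S) (hT : WeakBdd β T) : WeakBdd (α + β) (S * T) := by
  obtain ⟨C, hC, hS⟩ := hS
  obtain ⟨D, hD, hT⟩ := hT
  exact ⟨_, by positivity, hS.mul hT hC.le⟩

theorem mul_left (hT : WeakBdd α T) (A : H →L[ℂ] H) : WeakBdd α (A * T) := by
  obtain ⟨C, hC, hT⟩ := hT
  exact ⟨(‖A‖ + 1) * C, by positivity, (hT.mul_left A).mono (by gcongr; linarith)⟩

theorem mul_right (hT : WeakBdd α T) (A : H →L[ℂ] H) : WeakBdd α (T * A) := by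
  obtain ⟨C, hC, hT⟩ := hT
  exact ⟨C * (‖A‖ + 1), by positivity, (hT.mul_right hC.le A).mono (by gcongr; linarith)⟩

theorem neg (hT : WeakBdd α T) : WeakBdd α (-T) := by
  obtain ⟨C, hC, hT⟩ := hT
  exact ⟨C, hC, hT.neg⟩

theorem sub (hS : WeakBdd α S) (hT : WeakBdd α T) : WeakBdd α (S - T) := by
  rw [sub_eq_add_neg]; exact hS.add hT.neg

theorem rpow (hS : 0 ≤ S) (h : WeakBdd α S) (h0 : 0 < θ) (h1 : θ ≤ 1) :
    WeakBdd (α * θ) (S ^ θ) := by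
  obtain ⟨C, hC, hT⟩ := h
  exact ⟨_, by positivity, hT.rpow hS hC h0 h1⟩

end WeakBdd

namespace Negl

theorem zero : Negl α (0 : H →L[ℂ] H) := fun C hC => by
  filter_upwards [eventually_gt_atTop 0] with x hx
  exact BoundedOff.of_norm_le hx.le (by rw [norm_zero]; positivity)

theorem add (hS : Negl α S) (hT : Negl α T) : Negl α (S + T) := fun C hC => by
  convert (hS (C / 2 ^ α / 2) (by positivity)).add (hT (C / 2 ^ α / 2) (by positivity)) using 1
  field_simp
  ring

theorem neg (hT : Negl α T) : Negl α (-T) := fun C hC => (hT C hC).neg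

theorem symm (h : Negl α (S - T)) : Negl α (T - S) := by simpa using h.neg

theorem trans (h : Negl α (S - T)) (h' : Negl α (T - R)) : Negl α (S - R) := by
  simpa using h.add h'

theorem star (hT : Negl α T) : Negl α (star T) := fun C hC => (hT C hC).star hC.le

theorem mul_left (hT : Negl α T) (A : H →L[ℂ] H) : Negl α (A * T) := fun C hC =>
  ((hT (C / (‖A‖ + 1)) (by positivity)).mul_left A).mono (by
    rw [mul_div_assoc', div_le_iff₀ (by positivity)]; nlinarith)

theorem mul_right (hT : Negl α T) (A : H →L[ℂ] H) : Negl α (T * A) := fun C hC =>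
  ((hT (C / (‖A‖ + 1)) (by positivity)).mul_right (by positivity) A).mono (by
    rw [div_mul_eq_mul_div, div_le_iff₀ (by positivity)]; nlinarith)

theorem mul (hS : Negl α S) (hT : WeakBdd β T) : Negl (α + β) (S * T) := fun C hC => by
  obtain ⟨D, hD, hT⟩ := hT
  convert (hS (C / D / 2 ^ (α + β)) (by positivity)).mul hT (by positivity) using 1
  field_simp

theorem mul' (hS : WeakBdd α S) (hT : Negl β T) : Negl (α + β) (S * T) := fun C hC => by
  obtain ⟨D, hD, hS⟩ := hS
  convert hS.mul (hT (C / D / 2 ^ (α + β)) (by positivity)) hD.le using 1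
  field_simp

/-- Products of operators that agree up to negligible ones. -/
theorem mul_sub_mul {S' T' : H →L[ℂ] H} (hS : Negl α (S - S')) (hT : Negl β (T - T'))
    (hSb : WeakBdd α S') (hTb : WeakBdd β T) : Negl (α + β) (S * T - S' * T') := by
  have : S * T - S' * T' = (S - S') * T + S' * (T - T') := by noncomm_ring
  rw [this]
  exact (hS.mul hTb).add (mul' hSb hT)

theorem weakBdd_of_sub (h : Negl α (S - T)) (hT : WeakBdd α T) : WeakBdd α S := by
  simpa using h.weakBdd.add hT

end Negl

end

/-! ### Ky Fan sums and differences of square roots -/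

section
variable {S T K G : H →L[ℂ] H} {α β C D θ : ℝ} {n : ℕ} {v : Fin n → H}

/-- The sum is a partial trace of G*G for a contraction of rank at most dim W: expand G v_i in an
orthonormal basis of W, exchange the sums, and apply Bessel's inequality to the v_i. -/
theorem sum_norm_sq_apply_le (hv : Orthonormal ℂ v) (hG : ‖G‖ ≤ 1) {W : Submodule ℂ H}
    [FiniteDimensional ℂ W] (hW : ∀ x, G x ∈ W) :
    ∑ i, ‖G (v i)‖ ^ 2 ≤ Module.finrank ℂ W := by
  let e := stdOrthonormalBasis ℂ W
  have h1 : ∀ i, ‖G (v i)‖ ^ 2 = ∑ l, ‖(inner ℂ (v i) (star G (e l : H)) : ℂ)‖ ^ 2 := fun i => by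
    have := e.sum_sq_norm_inner_right (⟨G (v i), hW _⟩ : W)
    rw [Submodule.coe_norm] at this
    rw [← this]
    refine Finset.sum_congr rfl fun l _ => ?_
    rw [Submodule.coe_inner, ContinuousLinearMap.star_eq_adjoint,
      ContinuousLinearMap.adjoint_inner_right, norm_inner_symm]
  simp_rw [h1]
  rw [Finset.sum_comm]
  calc _ ≤ ∑ l, ‖star G (e l : H)‖ ^ 2 :=
        Finset.sum_le_sum fun l _ => hv.sum_inner_products_le _
    _ ≤ ∑ _l : Fin (Module.finrank ℂ W), (1 : ℝ) := by
        refine Finset.sum_le_sum fun l _ => ?_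
        have h2 : ‖(e l : H)‖ = 1 := e.orthonormal.1 l
        have h3 := (star G).le_of_opNorm_le (c := 1) (by rwa [norm_star]) (e l : H)
        rw [h2, mul_one] at h3
        exact pow_le_one₀ (norm_nonneg _) h3
    _ = _ := by simp

theorem abs_re_inner_le_projection (hK : IsSelfAdjoint K) {V : Submodule ℂ H}
    [FiniteDimensional ℂ V] {t : ℝ} (ht : 0 ≤ t) (hV : ∀ x ∈ Vᗮ, ‖K x‖ ≤ t * ‖x‖) (w : H) :
    |RCLike.re (inner ℂ (K w) w)| ≤
      |RCLike.re (inner ℂ (K (V.starProjection w)) (V.starProjection w))| + 2 * t * ‖w‖ ^ 2 := by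
  set a := V.starProjection w with ha
  set b := w - a with hb
  have hbV : b ∈ Vᗮ := V.sub_starProjection_mem_orthogonal w
  have hw : w = a + b := by simp [hb]
  have hn : ‖w‖ ^ 2 = ‖a‖ ^ 2 + ‖b‖ ^ 2 := by
    have h2 := V.norm_sq_eq_add_norm_sq_starProjection w
    rwa [show Vᗮ.starProjection w = b by simp [Submodule.starProjection_orthogonal, hb, ha]] at h2
  have hna : ‖a‖ ≤ ‖w‖ := by nlinarith [norm_nonneg a, norm_nonneg w, sq_nonneg ‖b‖]
  have hnb : ‖b‖ ≤ ‖w‖ := by nlinarith [norm_nonneg b, norm_nonneg w, sq_nonneg ‖a‖]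
  have hs : inner ℂ (K a) b = inner ℂ a (K b) := by
    conv_lhs => rw [← hK.star_eq, ContinuousLinearMap.star_eq_adjoint]
    rw [ContinuousLinearMap.adjoint_inner_left]
  have e : RCLike.re (inner ℂ (K w) w) = RCLike.re (inner ℂ (K a) a) +
      RCLike.re (inner ℂ a (K b)) + RCLike.re (inner ℂ (K b) w) := by
    conv_lhs => rw [hw, map_add, inner_add_left, inner_add_right, hs]
    rw [map_add, map_add, ← hw]
  have hb1 : ‖K b‖ ≤ t * ‖w‖ := (hV b hbV).trans (by gcongr)
  have h1 : |RCLike.re (inner ℂ a (K b))| ≤ ‖w‖ * (t * ‖w‖) :=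
    (RCLike.abs_re_le_norm _).trans ((norm_inner_le_norm _ _).trans (by gcongr))
  have h2 : |RCLike.re (inner ℂ (K b) w)| ≤ (t * ‖w‖) * ‖w‖ :=
    (RCLike.abs_re_le_norm _).trans ((norm_inner_le_norm _ _).trans (by gcongr))
  rw [e]
  refine (abs_add_three _ _ _).trans ?_
  linarith

/-- The constant in the bound for sums of the first singular values. -/
def kyFanConst (β : ℝ) : ℝ := 4 / (1 - 2 ^ (β - 1))

theorem two_rpow_lt_one (hβ : β < 1) : (2 : ℝ) ^ (β - 1) < 1 :=
  Real.rpow_lt_one_of_one_lt_of_neg (by norm_num) (by linarith)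

theorem kyFanConst_pos (hβ : β < 1) : 0 < kyFanConst β := by
  have := two_rpow_lt_one hβ
  unfold kyFanConst
  exact div_pos (by norm_num) (by linarith)

/-- Fixed point of the recursion that one dyadic step imposes on the constant in
`sum_abs_re_inner_comp_le`. -/
theorem kyFanConst_eq (hβ : β < 1) : kyFanConst β * 2 ^ (β - 1) + 4 = kyFanConst β := by
  have := two_rpow_lt_one hβ
  have h : 1 - (2 : ℝ) ^ (β - 1) ≠ 0 := by linarith
  unfold kyFanConst
  field_simp
  ring

/-- Dyadic induction on the rank bound d of G. Projecting onto the exceptional space of K at d/2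
halves the rank and costs 2td with t = C(d/2)^{-β}, which is of order d^{1-β}; as β < 1, these costs
sum geometrically. Once d ≤ 2x₀, the norm of K is used. -/
theorem sum_abs_re_inner_comp_le (hv : Orthonormal ℂ v) (hK : IsSelfAdjoint K) 
    (hβ : β < 1) (hC : 0 ≤ C) {x₀ : ℝ} (hx₀ : 0 < x₀)
    (h : ∀ x ≥ x₀, BoundedOff K x (C * x ^ (-β))) (J : ℕ) :
    ∀ (d : ℝ) (G : H →L[ℂ] H) (W : Submodule ℂ H), 0 ≤ d → d ≤ 2 * x₀ * 2 ^ J → ‖G‖ ≤ 1 →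
      FiniteDimensional ℂ W → (Module.finrank ℂ W : ℝ) ≤ d → (∀ x, G x ∈ W) →
      ∑ i, |RCLike.re (inner ℂ (K (G (v i))) (G (v i)))| ≤
        kyFanConst β * C * d ^ (1 - β) + 2 * ‖K‖ * x₀ := by
  have hc := kyFanConst_pos hβ
  have base : ∀ (d : ℝ) (G : H →L[ℂ] H) (W : Submodule ℂ H), 0 ≤ d → d ≤ 2 * x₀ → ‖G‖ ≤ 1 →
      FiniteDimensional ℂ W → (Module.finrank ℂ W : ℝ) ≤ d → (∀ x, G x ∈ W) →
      ∑ i, |RCLike.re (inner ℂ (K (G (v i))) (G (v i)))| ≤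
        kyFanConst β * C * d ^ (1 - β) + 2 * ‖K‖ * x₀ := by
    intro d G W hd0 hd hG hW hWd hGW
    calc _ ≤ ∑ i, ‖K‖ * ‖G (v i)‖ ^ 2 := by
          refine Finset.sum_le_sum fun i _ => (RCLike.abs_re_le_norm _).trans
            ((norm_inner_le_norm _ _).trans ?_)
          rw [sq, ← mul_assoc]
          gcongr
          exact K.le_opNorm _
      _ ≤ ‖K‖ * (2 * x₀) := by
          rw [← Finset.mul_sum]
          gcongr
          exact (sum_norm_sq_apply_le hv hG hGW).trans (hWd.trans hd)
      _ ≤ _ := by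
          have : 0 ≤ kyFanConst β * C * d ^ (1 - β) := by positivity
          linarith
  induction J with
  | zero => intro d G W hd0 hd; exact base d G W hd0 (by simpa using hd)
  | succ J ih =>
    intro d G W hd0 hd hG hW hWd hGW
    rcases le_or_gt d (2 * x₀) with hd1 | hd1
    · exact base d G W hd0 hd1 hG hW hWd hGW
    have hdpos : 0 < d := by linarith
    obtain ⟨V, hV, hVd, hVt⟩ := h (d / 2) (by linarith)
    set t := C * (d / 2) ^ (-β) with ht
    have ht0 : 0 ≤ t := by positivity
    have hPG : ‖V.starProjection * G‖ ≤ 1 :=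
      (norm_mul_le _ _).trans (mul_le_one₀ (Submodule.starProjection_norm_le _) (norm_nonneg _) hG)
    have h1 := ih (d / 2) (V.starProjection * G) V (by positivity)
      (by rw [pow_succ] at hd; linarith) hPG hV hVd fun x => V.starProjection_apply_mem _
    have e1 : (d / 2) ^ (1 - β) = 2 ^ (β - 1) * d ^ (1 - β) := by
      have := half_rpow_neg hdpos (β - 1)
      rwa [neg_sub] at this
    have e2 : t * d = 2 ^ β * C * d ^ (1 - β) := by
      have : d ^ (1 - β) = d ^ (-β) * d := by
        rw [sub_eq_neg_add, Real.rpow_add hdpos, Real.rpow_one]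
      rw [ht, half_rpow_neg hdpos, this]; ring
    have e3 : (2 : ℝ) ^ β ≤ 2 := by
      calc (2 : ℝ) ^ β ≤ 2 ^ (1 : ℝ) := Real.rpow_le_rpow_of_exponent_le (by norm_num) hβ.le
        _ = 2 := by simp
    calc _ ≤ ∑ i, (|RCLike.re (inner ℂ (K ((V.starProjection * G) (v i)))
            ((V.starProjection * G) (v i)))| + 2 * t * ‖G (v i)‖ ^ 2) :=
          Finset.sum_le_sum fun i _ => abs_re_inner_le_projection hK ht0 hVt _
      _ ≤ (kyFanConst β * C * (d / 2) ^ (1 - β) + 2 * ‖K‖ * x₀) + 2 * t * d := by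
          rw [Finset.sum_add_distrib, ← Finset.mul_sum]
          gcongr
          exact (sum_norm_sq_apply_le hv hG hGW).trans hWd
      _ = (kyFanConst β * 2 ^ (β - 1) + 2 * 2 ^ β) * (C * d ^ (1 - β)) + 2 * ‖K‖ * x₀ := by
          rw [e1, mul_assoc 2 t d, e2]; ring
      _ ≤ (kyFanConst β * 2 ^ (β - 1) + 4) * (C * d ^ (1 - β)) + 2 * ‖K‖ * x₀ := by
          gcongr; linarith
      _ = _ := by rw [kyFanConst_eq hβ]; ring

theorem sum_abs_re_inner_le (hv : Orthonormal ℂ v) (hK : IsSelfAdjoint K) 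
    (hβ : β < 1) (hC : 0 ≤ C) {x₀ : ℝ} (hx₀ : 0 < x₀)
    (h : ∀ x ≥ x₀, BoundedOff K x (C * x ^ (-β))) :
    ∑ i, |RCLike.re (inner ℂ (K (v i)) (v i))| ≤
      kyFanConst β * C * (n : ℝ) ^ (1 - β) + 2 * ‖K‖ * x₀ := by
  obtain ⟨J, hJ⟩ := pow_unbounded_of_one_lt (n / (2 * x₀)) (one_lt_two : (1 : ℝ) < 2)
  let W := Submodule.span ℂ (Set.range v)
  have hfd : FiniteDimensional ℂ W := FiniteDimensional.span_of_finite ℂ (Set.finite_range v)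
  have hW : (Module.finrank ℂ W : ℝ) ≤ n := by
    have := finrank_range_le_card (R := ℂ) v
    rw [Fintype.card_fin] at this
    exact_mod_cast this
  have h1 := sum_abs_re_inner_comp_le hv hK hβ hC hx₀ h J n W.starProjection W (by positivity)
    (by rw [div_lt_iff₀ (by positivity)] at hJ; linarith) (Submodule.starProjection_norm_le _)
    hfd hW (fun x => W.starProjection_apply_mem x)
  have h2 : ∀ i, W.starProjection (v i) = v i := fun i =>
    Submodule.starProjection_eq_self_iff.2 (Submodule.subset_span ⟨i, rfl⟩)
  simpa only [h2] using h1

/-- With s, t the values of the forms of S, T at x, the right side is |μ|(s + t). Positivity of s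
and t and s - t = μ give s + t ≥ |μ|. -/
theorem abs_re_inner_sq_sub_sq (hS : 0 ≤ S) (hT : 0 ≤ T) {x : H} (hx : ‖x‖ = 1) {μ : ℝ}
    (h : (S - T) x = (μ : ℂ) • x) :
    μ ^ 2 ≤ |RCLike.re (inner ℂ ((S * S - T * T) x) x)| := by
  have hS' := (IsSelfAdjoint.of_nonneg hS).star_eq
  have hT' := (IsSelfAdjoint.of_nonneg hT).star_eq
  have e1 : RCLike.re (inner ℂ ((S * S - T * T) x) x) = ‖S x‖ ^ 2 - ‖T x‖ ^ 2 := by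
    rw [sub_apply, inner_sub_left, map_sub, ← re_inner_star_mul_self, ← re_inner_star_mul_self,
      hS', hT']
  have hSx : S x = T x + (μ : ℂ) • x := by
    rw [← h, sub_apply]; abel
  have hxx : RCLike.re (inner ℂ x x : ℂ) = 1 := by rw [inner_self_eq_norm_sq, hx]; norm_num
  set s := RCLike.re (inner ℂ (S x) x) with hs
  set t := RCLike.re (inner ℂ (T x) x) with ht
  have hs0 : 0 ≤ s := re_inner_nonneg hS x
  have ht0 : 0 ≤ t := re_inner_nonneg hT x
  have hst : s = t + μ := by
    rw [hs, hSx, inner_add_left, map_add, inner_smul_left, Complex.conj_ofReal, ← ht]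
    congr 1
    rw [RCLike.re_eq_complex_re, Complex.re_ofReal_mul, ← RCLike.re_eq_complex_re, hxx, mul_one]
  have e2 : ‖S x‖ ^ 2 = ‖T x‖ ^ 2 + 2 * (μ * t) + μ ^ 2 := by
    rw [hSx, norm_add_sq (𝕜 := ℂ), inner_smul_right, norm_smul, hx, RCLike.re_eq_complex_re,
      Complex.re_ofReal_mul, ← RCLike.re_eq_complex_re, ← ht]
    simp
  rw [e1, e2, show ‖T x‖ ^ 2 + 2 * (μ * t) + μ ^ 2 - ‖T x‖ ^ 2 = μ * (s + t) by rw [hst]; ring,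
    abs_mul, abs_of_nonneg (add_nonneg hs0 ht0), ← sq_abs, sq]
  gcongr
  exact abs_le.2 ⟨by linarith, by linarith⟩

theorem orthonormal_eigenvectors {D : H →L[ℂ] H} (hD : IsSelfAdjoint D) {U : Submodule ℂ H}
    [FiniteDimensional ℂ U] (hU : ∀ x ∈ U, D x ∈ U) :
    ∃ (v : Fin (Module.finrank ℂ U) → H) (μ : Fin (Module.finrank ℂ U) → ℝ), Orthonormal ℂ v ∧
      (∀ i, v i ∈ U) ∧ ∀ i, D (v i) = (μ i : ℂ) • v i := by
  have hsym : (D : H →ₗ[ℂ] H).IsSymmetric :=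
    ContinuousLinearMap.isSelfAdjoint_iff_isSymmetric.1 hD
  have hr := hsym.restrict_invariant (V := U) hU
  refine ⟨fun i => hr.eigenvectorBasis rfl i, hr.eigenvalues rfl, ?_, fun i => (hr.eigenvectorBasis rfl i).2,
    fun i => ?_⟩
  · exact (hr.eigenvectorBasis rfl).orthonormal.comp_linearIsometry U.subtypeₗᵢ
  · have := hr.apply_eigenvectorBasis rfl i
    exact congrArg Subtype.val this

theorem apply_mem_range_posTail_abs {D : H →L[ℂ] H} (hD : IsSelfAdjoint D) (t : ℝ) :
    ∀ x ∈ (posTail (CFC.abs D) t).toLinearMap.range,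
      D x ∈ (posTail (CFC.abs D) t).toLinearMap.range := by
  have h1 : Commute (CFC.abs D) D := CFC.commute_abs_self D hD.isStarNormal
  have h2 : Commute (posTail (CFC.abs D) t) D := h1.cfc_real _
  rintro _ ⟨y, rfl⟩
  exact ⟨D y, congrArg (fun A : H →L[ℂ] H => A y) h2.eq⟩

/-- The difference of the square roots of two positive operators is controlled by the square root
of their difference. -/
theorem WeakDecay.sub_of_mul_self_sub (hS : 0 ≤ S) (hT : 0 ≤ T) (hβ0 : 0 < β) (hβ : β < 1)
    (hα : 0 < α) (hST : WeakBdd α (S - T)) (hC : 0 < C) (h : WeakDecay β C (S * S - T * T)) :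
    WeakDecay (β / 2) (√(2 * kyFanConst β * C)) (S - T) := by
  have hc := kyFanConst_pos hβ
  set K := S * S - T * T with hKdef
  have hS' := IsSelfAdjoint.of_nonneg hS
  have hT' := IsSelfAdjoint.of_nonneg hT
  have hK : IsSelfAdjoint K := by
    refine IsSelfAdjoint.sub ?_ ?_
    · simp [isSelfAdjoint_iff, hS'.star_eq]
    · simp [isSelfAdjoint_iff, hT'.star_eq]
  obtain ⟨x₀, hx₀1, hx₀⟩ : ∃ x₀ : ℝ, 0 < x₀ ∧ ∀ x ≥ x₀, BoundedOff K x (C * x ^ (-β)) := by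
    obtain ⟨x₀, hx₀⟩ := eventually_atTop.1 h
    exact ⟨max x₀ 1, by positivity, fun x hx => hx₀ x ((le_max_left _ _).trans hx)⟩
  have hlim : Tendsto (fun x : ℝ => kyFanConst β * C * x ^ (1 - β)) atTop atTop :=
    (tendsto_rpow_atTop (by linarith)).const_mul_atTop (by positivity)
  filter_upwards [hlim.eventually_gt_atTop (2 * ‖K‖ * x₀), eventually_gt_atTop 0] with x hx hx0
  set l := √(2 * kyFanConst β * C) * x ^ (-(β / 2)) with hl
  have hl0 : 0 < l := by positivity
  have hl2 : l ^ 2 = 2 * kyFanConst β * C * x ^ (-β) := by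
    rw [hl, mul_pow, Real.sq_sqrt (by positivity), ← Real.rpow_natCast (x ^ _),
      ← Real.rpow_mul hx0.le]
    push_cast; ring_nf
  set D := S - T with hDdef
  have hD : IsSelfAdjoint D := hS'.sub hT'
  set U := (posTail (CFC.abs D) l).toLinearMap.range with hUdef
  have hUb : ∀ y ∈ U, l * ‖y‖ ≤ ‖D y‖ := fun y hy => by
    rw [← norm_abs_apply]
    exact le_norm_apply_of_mem_range_posTail (CFC.abs_nonneg D) hl0.le hy
  -- The hypothesis on S - T is used only here, qualitatively; its order α does not enter the
  -- conclusion.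
  have hfd : FiniteDimensional ℂ U := by
    obtain ⟨C', hC', hw⟩ := hST
    have htend : Tendsto (fun k : ℕ => C' * (k : ℝ) ^ (-α)) atTop (𝓝 (C' * 0)) :=
      ((tendsto_rpow_neg_atTop hα).comp tendsto_natCast_atTop_atTop).const_mul C'
    rw [mul_zero] at htend
    obtain ⟨k, hk1, hk2⟩ := ((htend.eventually_lt_const hl0).and
      ((tendsto_natCast_atTop_atTop (R := ℝ)).eventually hw)).exists
    exact Module.rank_lt_aleph0_iff.1 ((hk2.rank_le hk1 hUb).trans_lt Cardinal.natCast_lt_aleph0)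
  refine ⟨U, hfd, ?_, fun y hy => ?_⟩
  -- If n > x, the n eigenvectors force n l² ≤ kyFanConst β · C · n^{1-β} + 2‖K‖x₀. The factor 2 in
  -- l² leaves half of the left side after n^{1-β} ≤ n x^{-β}, and that half exceeds the constant
  -- term for large x.
  · by_contra! hn
    set n := Module.finrank ℂ U with hndef
    obtain ⟨v, μ, hv, hvU, hvμ⟩ := orthonormal_eigenvectors hD
      (apply_mem_range_posTail_abs hD l)
    have h1 := sum_abs_re_inner_le hv hK hβ hC.le hx₀1 hx₀
    have h2 : ∀ i, l ^ 2 ≤ |RCLike.re (inner ℂ (K (v i)) (v i))| := fun i => by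
      refine le_trans ?_ (abs_re_inner_sq_sub_sq hS hT (hv.1 i) (hvμ i))
      have := hUb _ (hvU i)
      rw [hvμ i, norm_smul, hv.1 i, mul_one, mul_one, Complex.norm_real, Real.norm_eq_abs] at this
      rw [← sq_abs (μ i)]
      gcongr
    have h3 : (n : ℝ) * l ^ 2 ≤ kyFanConst β * C * (n : ℝ) ^ (1 - β) + 2 * ‖K‖ * x₀ := by
      refine le_trans ?_ h1
      have := Finset.sum_le_sum (s := Finset.univ) fun i _ => h2 i
      simpa using this
    have hn0 : (0 : ℝ) < n := hx0.trans hn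
    have h4 : (n : ℝ) ^ (1 - β) ≤ n * x ^ (-β) := by
      rw [sub_eq_neg_add, Real.rpow_add hn0, Real.rpow_one, mul_comm]
      gcongr ?_ * ?_
      exact Real.rpow_le_rpow_of_nonpos hx0 hn.le (by linarith)
    have h5 : x ^ (1 - β) ≤ (n : ℝ) ^ (1 - β) :=
      Real.rpow_le_rpow hx0.le hn.le (by linarith)
    have hcC : 0 < kyFanConst β * C := by positivity
    have h6 := mul_le_mul_of_nonneg_left h4 hcC.le
    have h7 := mul_le_mul_of_nonneg_left h5 hcC.le
    rw [hl2] at h3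
    nlinarith
  · rw [← norm_abs_apply]
    exact norm_apply_le_of_posTail_eq_zero (CFC.abs_nonneg D) hl0.le
      (apply_eq_zero_of_mem_range_orthogonal (isSelfAdjoint_posTail _ _) hy)

theorem Negl.sub_of_mul_self_sub (hS : 0 ≤ S) (hT : 0 ≤ T) (hβ0 : 0 < β) (hβ : β < 1)
    (hα : 0 < α) (hST : WeakBdd α (S - T)) (h : Negl β (S * S - T * T)) :
    Negl (β / 2) (S - T) := fun C hC => by
  have hc := kyFanConst_pos hβ
  have hpos : 0 < C ^ 2 / (2 * kyFanConst β) := by positivity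
  convert (h _ hpos).sub_of_mul_self_sub hS hT hβ0 hβ hα hST hpos using 1
  rw [mul_div_cancel₀ _ (by positivity), Real.sqrt_sq hC.le]

end

/-! ### Hansen's inequality and Douglas' factorization -/

section
variable {S T R Y F c A : H →L[ℂ] H} {α β C D M θ t : ℝ}

theorem rpow_mul_rpow (hA : 0 ≤ A) {x y : ℝ} (hx : 0 ≤ x) (hy : 0 ≤ y) :
    A ^ x * A ^ y = A ^ (x + y) := by
  rw [CFC.rpow_eq_cfc_real hA, CFC.rpow_eq_cfc_real hA, CFC.rpow_eq_cfc_real hA,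
    ← cfc_mul _ _ _ (Real.continuous_rpow_const hx).continuousOn
      (Real.continuous_rpow_const hy).continuousOn]
  exact cfc_congr fun z hz => (Real.rpow_add_of_nonneg (spectrum_nonneg hA hz) hx hy).symm

theorem isSelfAdjoint_rpow (A : H →L[ℂ] H) (x : ℝ) : IsSelfAdjoint (A ^ x) :=
  IsSelfAdjoint.of_nonneg CFC.rpow_nonneg

/-- Completing the square. The relation `hF` says F = R(t + R)⁻¹, and t⟨Fu, u⟩ is the minimum over w
of ⟨R(u - w), u - w⟩ + t‖w‖², attained at w = Fu; v is the deviation from the minimizer. -/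
theorem re_inner_parallel_sum_add (hR : IsSelfAdjoint R) (hF : R * (1 - F) = (t : ℂ) • F)
    (u v : H) :
    RCLike.re (inner ℂ (R (u - (F u + v))) (u - (F u + v))) + t * ‖F u + v‖ ^ 2 =
      t * RCLike.re (inner ℂ (F u) u) + (RCLike.re (inner ℂ (R v) v) + t * ‖v‖ ^ 2) := by
  have h1 : R (u - F u) = (t : ℂ) • F u := by
    have := congrArg (fun A : H →L[ℂ] H => A u) hF
    simpa using this
  obtain ⟨p, hp⟩ : ∃ p, p = u - F u := ⟨_, rfl⟩
  rw [← hp] at h1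
  have e : u - (F u + v) = p - v := by rw [hp]; abel
  have hs : inner ℂ (R v) p = inner ℂ v (R p) := by
    conv_lhs => rw [← hR.star_eq, ContinuousLinearMap.star_eq_adjoint]
    rw [ContinuousLinearMap.adjoint_inner_left]
  have hsw : RCLike.re (inner ℂ v (F u)) = RCLike.re (inner ℂ (F u) v) := inner_re_symm _ _
  have hu : RCLike.re (inner ℂ (F u) u) = RCLike.re (inner ℂ (F u) p) + ‖F u‖ ^ 2 := by
    have : u = p + F u := by rw [hp]; abel
    conv_lhs => rw [this, inner_add_right, map_add]
    rw [← this, inner_self_eq_norm_sq]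
  have ht : ∀ z : ℂ, RCLike.re ((t : ℂ) * z) = t * RCLike.re z := fun z => by
    rw [RCLike.re_eq_complex_re, Complex.re_ofReal_mul]
  rw [e, map_sub, inner_sub_left, inner_sub_right, inner_sub_right, hs, h1, inner_smul_left,
    inner_smul_left, inner_smul_right, Complex.conj_ofReal, norm_add_sq (𝕜 := ℂ), hu]
  simp only [map_sub, ht, hsw]
  ring

/-- In the variational problem for R at cx, the competitor w = cF'x has energy at most that of the
minimizer F'x for c*Rc at x, because c is a contraction. -/
theorem re_inner_le_of_parallel_sum {F' : H →L[ℂ] H} (hR : 0 ≤ R) (ht : 0 < t) (hc : ‖c‖ ≤ 1)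
    (hF : R * (1 - F) = (t : ℂ) • F) (hF' : (star c * R * c) * (1 - F') = (t : ℂ) • F') (x : H) :
    RCLike.re (inner ℂ (F (c x)) (c x)) ≤ RCLike.re (inner ℂ (F' x) x) := by
  have hRs := IsSelfAdjoint.of_nonneg hR
  have hY : IsSelfAdjoint (star c * R * c) := hRs.conjugate' c
  have h1 := re_inner_parallel_sum_add hRs hF (c x) (c (F' x) - F (c x))
  have h2 := re_inner_parallel_sum_add hY hF' x 0
  simp only [add_sub_cancel, add_zero, map_zero, inner_zero_left, norm_zero,
    zero_pow two_ne_zero, mul_zero] at h1 h2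
  have h3 : RCLike.re (inner ℂ (R (c x - c (F' x))) (c x - c (F' x))) =
      RCLike.re (inner ℂ ((star c * R * c) (x - F' x)) (x - F' x)) := by
    rw [mul_apply_eq_comp, mul_apply_eq_comp, ContinuousLinearMap.star_eq_adjoint,
      ContinuousLinearMap.adjoint_inner_left, show c (x - F' x) = c x - c (F' x) from map_sub _ _ _]
  have h4 : ‖c (F' x)‖ ^ 2 ≤ ‖F' x‖ ^ 2 := by
    gcongr
    simpa using c.le_of_opNorm_le hc (F' x)
  have h5 := re_inner_nonneg hR (c (F' x) - F (c x))
  have h6 : 0 ≤ t * ‖c (F' x) - F (c x)‖ ^ 2 := by positivity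
  rw [h3] at h1
  have h7 := mul_le_mul_of_nonneg_left h4 ht.le
  refine le_of_mul_le_mul_left ?_ ht
  linarith

theorem cfcn_rpowIntegrand_eq {p : ℝ} (hR : 0 ≤ R) (ht : 0 < t) :
    ∃ F : H →L[ℂ] H, R * (1 - F) = (t : ℂ) • F ∧
      cfcₙ (Real.rpowIntegrand₀₁ p t) R = (t ^ (p - 1)) • F := by
  have hc : ContinuousOn (fun x : ℝ => x / (t + x)) (spectrum ℝ R) :=
    continuousOn_id.div (continuousOn_const.add continuousOn_id) fun x hx => by
      have := spectrum_nonneg hR hx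
      positivity
  refine ⟨cfc (fun x : ℝ => x / (t + x)) R, ?_, ?_⟩
  · have h1 : (1 : H →L[ℂ] H) - cfc (fun x : ℝ => x / (t + x)) R =
        cfc (fun x : ℝ => 1 - x / (t + x)) R := by
      rw [cfc_sub _ _ _ continuousOn_const hc, cfc_const_one ℝ R]
    have h2 : R * cfc (fun x : ℝ => 1 - x / (t + x)) R =
        cfc (fun x : ℝ => x * (1 - x / (t + x))) R := by
      rw [cfc_mul (fun x : ℝ => x) (fun x : ℝ => 1 - x / (t + x)) R continuousOn_id
        (continuousOn_const.sub hc), cfc_id' ℝ R]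
    rw [h1, h2, Complex.coe_smul, ← cfc_smul _ _ _ hc]
    refine cfc_congr fun x hx => ?_
    have := spectrum_nonneg hR hx
    have h3 : t + x ≠ 0 := by positivity
    simp only [smul_eq_mul]
    field_simp
    ring
  · have h1 : ∀ x ∈ spectrum ℝ R, Real.rpowIntegrand₀₁ p t x = t ^ (p - 1) • (x / (t + x)) :=
      fun x hx => by
        have := spectrum_nonneg hR hx
        have h3 : t + x ≠ 0 := by positivity
        rw [Real.rpowIntegrand₀₁, Real.rpow_sub_one ht.ne', smul_eq_mul]
        field_simp
        ring
    have hc2 : ContinuousOn (Real.rpowIntegrand₀₁ p t) (spectrum ℝ R) :=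
      (hc.const_smul (t ^ (p - 1))).congr h1
    have hq : quasispectrum ℝ R = spectrum ℝ R ∪ {0} :=
      quasispectrum_eq_spectrum_union_zero ℝ R
    have hc3 : ContinuousOn (Real.rpowIntegrand₀₁ p t) (quasispectrum ℝ R) := by
      have hc' : ContinuousOn (fun x : ℝ => x / (t + x)) (quasispectrum ℝ R) :=
        continuousOn_id.div (continuousOn_const.add continuousOn_id) fun x hx => by
          have := quasispectrum_nonneg_of_nonneg R hR x hx
          positivity
      refine (hc'.const_smul (t ^ (p - 1))).congr fun x hx => ?_
      have := quasispectrum_nonneg_of_nonneg R hR x hx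
      have h3 : t + x ≠ 0 := by positivity
      simp only [Real.rpowIntegrand₀₁, Real.rpow_sub_one ht.ne', smul_eq_mul, Pi.smul_apply]
      field_simp
      ring
    rw [cfcₙ_eq_cfc hc3 (by simp), cfc_congr h1, cfc_smul _ _ _ hc]

/-- The quadratic form at `x` as a real-linear functional on operators. -/
def reInnerCLM (x : H) : (H →L[ℂ] H) →L[ℝ] ℝ :=
  RCLike.reCLM.comp (((innerSL ℂ x).comp (ContinuousLinearMap.apply ℂ H x)).restrictScalars ℝ)

theorem reInnerCLM_apply (x : H) (A : H →L[ℂ] H) :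
    reInnerCLM x A = RCLike.re (inner ℂ (A x) x) := by
  rw [inner_re_symm]; rfl

/-- **Hansen's inequality** for fractional powers. -/
theorem star_mul_rpow_mul_le (hR : 0 ≤ R) (hc : ‖c‖ ≤ 1) (h0 : 0 < θ) (h1 : θ < 1) :
    star c * R ^ θ * c ≤ (star c * R * c) ^ θ := by
  lift θ to NNReal using h0.le
  have hY : 0 ≤ star c * R * c := star_left_conjugate_nonneg hR c
  have h0' : 0 < θ := by exact_mod_cast h0
  -- The power is an integral of t^{θ-1} R(t + R)⁻¹ over t > 0, so the inequality of forms can be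
  -- checked for each t.
  obtain ⟨μ, hμ⟩ := CFC.exists_measure_nnrpow_eq_integral_cfcₙ_rpowIntegrand₀₁ (H →L[ℂ] H)
    (p := θ) ⟨h0', by exact_mod_cast h1⟩
  obtain ⟨i1, e1⟩ := hμ R hR
  obtain ⟨i2, e2⟩ := hμ _ hY
  rw [← CFC.nnrpow_eq_rpow h0', ← CFC.nnrpow_eq_rpow h0']
  refine le_of_re_inner_le ((IsSelfAdjoint.of_nonneg CFC.nnrpow_nonneg).conjugate' c)
    (IsSelfAdjoint.of_nonneg CFC.nnrpow_nonneg) fun x => ?_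
  have h3 : RCLike.re (inner ℂ ((star c * R ^ θ * c) x) x) = reInnerCLM (c x) (R ^ θ) := by
    rw [reInnerCLM_apply, mul_apply_eq_comp, mul_apply_eq_comp,
      ContinuousLinearMap.star_eq_adjoint, ContinuousLinearMap.adjoint_inner_left]
  rw [h3, ← reInnerCLM_apply, e1, e2, ← ContinuousLinearMap.integral_comp_comm _ i1,
    ← ContinuousLinearMap.integral_comp_comm _ i2]
  refine MeasureTheory.integral_mono_ae ((reInnerCLM (c x)).integrable_comp i1)
    ((reInnerCLM x).integrable_comp i2) ?_
  filter_upwards [MeasureTheory.ae_restrict_mem measurableSet_Ioi] with t ht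
  have ht : 0 < t := ht
  obtain ⟨F, hF, hF2⟩ := cfcn_rpowIntegrand_eq (p := θ) hR ht
  obtain ⟨F', hF', hF2'⟩ := cfcn_rpowIntegrand_eq (p := θ) hY ht
  simp only [hF2, hF2', map_smul, reInnerCLM_apply, smul_eq_mul]
  exact mul_le_mul_of_nonneg_left (re_inner_le_of_parallel_sum hR ht hc hF hF' x) (by positivity)

/-- **Douglas' factorization** of self-adjoint operators. -/
theorem exists_contraction_mul_eq {r s : H →L[ℂ] H} (hr : IsSelfAdjoint r) (hs : IsSelfAdjoint s)
    (h : ∀ x, ‖s x‖ ≤ ‖r x‖) : ∃ c : H →L[ℂ] H, ‖c‖ ≤ 1 ∧ r * c = s := by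
  let N : Submodule ℂ H := r.toLinearMap.range.topologicalClosure
  have hN : IsClosed (N : Set H) := Submodule.isClosed_topologicalClosure _
  have : CompleteSpace N := hN.completeSpace_coe
  let e : H →ₗ[ℂ] N := r.toLinearMap.codRestrict N fun x =>
    Submodule.le_topologicalClosure _ ⟨x, rfl⟩
  have he : DenseRange e := by
    have h1 : Dense (Subtype.val ⁻¹' (r.toLinearMap.range : Set H) : Set N) := by
      rw [Subtype.dense_iff]
      intro x hx
      have h2 : (r.toLinearMap.range : Set H) ⊆
          Subtype.val '' (Subtype.val ⁻¹' (r.toLinearMap.range : Set H) : Set N) := fun y hy =>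
        ⟨⟨y, Submodule.le_topologicalClosure _ hy⟩, hy, rfl⟩
      exact closure_mono h2 hx
    refine h1.mono ?_
    rintro y ⟨x, hx⟩
    exact ⟨x, Subtype.ext hx⟩
  have hn : ∀ x, ‖s.toLinearMap x‖ ≤ 1 * ‖e x‖ := fun x => by
    rw [one_mul]; exact h x
  let g : N →L[ℂ] H := s.toLinearMap.extendOfNorm e
  have hg : ∀ x, g (e x) = s x := LinearMap.extendOfNorm_eq he ⟨1, hn⟩
  have hg1 : ‖g‖ ≤ 1 := LinearMap.opNorm_extendOfNorm_le he zero_le_one hn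
  -- The map r x ↦ s x, extended to the closure of the range of r and by zero on its complement; the
  -- required factor is its adjoint.
  let k : H →L[ℂ] H := g.comp N.orthogonalProjectionOnto
  have hk : k * r = s := by
    ext x
    have h2 : N.orthogonalProjectionOnto (r x) = e x :=
      Submodule.orthogonalProjectionOnto_mem_subspace_eq_self (e x)
    change g (N.orthogonalProjectionOnto (r x)) = s x
    rw [h2, hg]
  have hk1 : ‖k‖ ≤ 1 := (ContinuousLinearMap.opNorm_comp_le _ _).trans
    (mul_le_one₀ hg1 (norm_nonneg _) (Submodule.orthogonalProjectionOnto_norm_le N))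
  refine ⟨star k, by rwa [norm_star], ?_⟩
  have := congrArg star hk
  rwa [star_mul, hr.star_eq, hs.star_eq] at this

end

/-! ### Continuity of fractional powers -/

section
variable {S T R c : H →L[ℂ] H} {α β C D M θ : ℝ}

theorem two_rpow_le_two {x : ℝ} (hx : x ≤ 1) : (2 : ℝ) ^ x ≤ 2 := by
  calc (2 : ℝ) ^ x ≤ 2 ^ (1 : ℝ) := Real.rpow_le_rpow_of_exponent_le (by norm_num) hx
    _ = 2 := by simp

theorem self_le_abs (hS : IsSelfAdjoint S) : S ≤ CFC.abs S := by
  have h := CFC.abs_sub_self S hS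
  rw [← sub_nonneg, h]
  exact nsmul_nonneg (CFC.negPart_nonneg S) 2

theorem rpow_sub_star_mul_rpow_mul_eq (c : H →L[ℂ] H) (Q : H →L[ℂ] H) (hQ : IsSelfAdjoint Q) :
    Q - star c * Q * c = star (Q * (1 - c)) + star c * (Q * (1 - c)) := by
  rw [star_mul, star_sub, star_one, hQ.star_eq]
  noncomm_ring

/-- Fractional powers: the case of two comparable operators. -/
theorem weakDecay_rpow_sub_rpow_of_le (hT : 0 ≤ T) (hTR : T ≤ R) (hβ0 : 0 < β) (hβ : β < 1)
    (h0 : 0 < θ) (h1 : θ < 1) (hM : 0 < M) (hC : 0 < C) (hR : WeakDecay β M R)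
    (hd : WeakDecay β C (R - T)) :
    WeakDecay (β * θ) (128 * (kyFanConst β * C * M) ^ (θ / 2)) (R ^ θ - T ^ θ) := by
  have hk := kyFanConst_pos hβ
  have hR0 : 0 ≤ R := hT.trans hTR
  set r := CFC.sqrt R with hr
  set s := CFC.sqrt T with hs
  have hr0 : 0 ≤ r := CFC.sqrt_nonneg R
  have hs0 : 0 ≤ s := CFC.sqrt_nonneg T
  have hrs := IsSelfAdjoint.of_nonneg hr0
  have hss := IsSelfAdjoint.of_nonneg hs0
  have hrr : r * r = R := CFC.sqrt_mul_sqrt_self R hR0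
  have hs2 : s * s = T := CFC.sqrt_mul_sqrt_self T hT
  -- With R^{1/2} c = T^{1/2} one has T = c*Rc, and R^{1/2}(1 - c) is exactly the difference of
  -- square roots. It remains to replace the exponent 1/2 by θ.
  obtain ⟨c, hc1, hc⟩ := exists_contraction_mul_eq hrs hss fun x => by
    rw [← sq_le_sq₀ (norm_nonneg _) (norm_nonneg _), norm_sqrt_apply_sq hT,
      norm_sqrt_apply_sq hR0]
    exact re_inner_le_of_le hTR x
  have hcs : star c * r = s := by
    have := congrArg star hc
    rwa [star_mul, hrs.star_eq, hss.star_eq] at this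
  have hcRc : star c * R * c = T := by
    rw [← hrr, ← hs2]
    calc star c * (r * r) * c = (star c * r) * (r * c) := by noncomm_ring
      _ = s * s := by rw [hc, hcs]
  -- the difference of the square roots
  have hRb : WeakBdd β R := ⟨M, hM, hR⟩
  have hTb : WeakBdd β T := by simpa using hRb.sub ⟨C, hC, hd⟩
  have hrb : WeakBdd (β * (1 / 2)) r := by
    rw [hr, CFC.sqrt_eq_rpow]; exact hRb.rpow hR0 (by norm_num) (by norm_num)
  have hsb : WeakBdd (β * (1 / 2)) s := by
    rw [hs, CFC.sqrt_eq_rpow]; exact hTb.rpow hT (by norm_num) (by norm_num)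
  have h2 : WeakDecay (β / 2) (√(2 * kyFanConst β * C)) (r - s) :=
    WeakDecay.sub_of_mul_self_sub hr0 hs0 hβ0 hβ (by positivity) (hrb.sub hsb) hC
      (by rwa [hrr, hs2])
  -- transfer to the power `θ`
  set d : H →L[ℂ] H := (1 / 2 : ℂ) • (1 - c) with hddef
  have hd1 : ‖d‖ ≤ 1 := by
    rw [hddef, norm_smul]
    have h3 : ‖(1 : H →L[ℂ] H) - c‖ ≤ 1 + 1 :=
      (norm_sub_le _ _).trans (add_le_add ContinuousLinearMap.norm_id_le hc1)
    have h4 : ‖(1 / 2 : ℂ)‖ = 1 / 2 := by norm_num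
    rw [h4]; linarith
  have hrd : WeakDecay (β / 2) (1 / 2 * √(2 * kyFanConst β * C)) (r * d) := by
    have : r * d = (1 / 2 : ℂ) • (r - s) := by
      rw [hddef, mul_smul_comm, mul_sub, mul_one, hc]
    rw [this]
    convert h2.smul (1 / 2) using 1
    norm_num
  have hdRd : WeakDecay β (kyFanConst β * C) (star d * R * d) := by
    have h3 := (hrd.star (by positivity)).mul hrd (by positivity)
    have h4 : star (r * d) * (r * d) = star d * R * d := by
      rw [star_mul, hrs.star_eq, ← hrr]; noncomm_ring
    rw [h4, add_halves] at h3
    refine h3.mono ?_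
    have h5 := Real.mul_self_sqrt (show 0 ≤ 2 * kyFanConst β * C by positivity)
    calc _ = 2 ^ β * (1 / 4 * (√(2 * kyFanConst β * C) * √(2 * kyFanConst β * C))) := by ring
      _ ≤ 2 * (1 / 4 * (√(2 * kyFanConst β * C) * √(2 * kyFanConst β * C))) := by
        gcongr; exact two_rpow_le_two hβ.le
      _ = _ := by rw [h5]; ring
  have hbt : β * θ ≤ 1 := by nlinarith
  have hbt2 : β * (θ / 2) ≤ 1 := by nlinarith
  have hdRd0 : 0 ≤ star d * R * d := star_left_conjugate_nonneg hR0 d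
  -- Hansen's inequality for the contraction d = (1 - c)/2: d*R^θ d ≤ (d*Rd)^θ.
  have hdQd : WeakDecay (β * θ) (4 * (kyFanConst β * C) ^ θ) (star d * R ^ θ * d) := by
    have h3 := (hdRd.rpow hdRd0 (by positivity) h0 h1.le).of_nonneg_of_le (by positivity)
      (star_left_conjugate_nonneg CFC.rpow_nonneg d) (star_mul_rpow_mul_le hR0 hd1 h0 h1)
    refine h3.mono ?_
    calc _ ≤ 2 * (2 * (kyFanConst β * C) ^ θ) := by
          gcongr <;> exact two_rpow_le_two hbt
      _ = _ := by ring
  have hhalf : R ^ (θ / 2) * R ^ (θ / 2) = R ^ θ := by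
    rw [rpow_mul_rpow hR0 (by positivity) (by positivity), add_halves]
  have hqd : WeakDecay (β * (θ / 2)) (2 * (kyFanConst β * C) ^ (θ / 2)) (R ^ (θ / 2) * d) := by
    refine WeakDecay.of_star_mul_self ?_ (by positivity)
    have h3 : star (R ^ (θ / 2) * d) * (R ^ (θ / 2) * d) = star d * R ^ θ * d := by
      rw [star_mul, (isSelfAdjoint_rpow R _).star_eq, ← hhalf]; noncomm_ring
    rw [h3]
    convert hdQd using 1
    · ring
    · rw [mul_pow, ← Real.rpow_natCast ((kyFanConst β * C) ^ (θ / 2)),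
        ← Real.rpow_mul (by positivity)]
      push_cast; ring_nf
  set Z := (kyFanConst β * C * M) ^ (θ / 2) with hZ
  have hZ0 : 0 ≤ Z := by positivity
  have hQc : WeakDecay (β * θ) (16 * Z) (R ^ θ * (1 - c)) := by
    have h3 := (hR.rpow hR0 hM (half_pos h0) (by linarith)).mul hqd (by positivity)
    have h4 := h3.smul 2
    have h5 : (2 : ℂ) • (R ^ (θ / 2) * (R ^ (θ / 2) * d)) = R ^ θ * (1 - c) := by
      rw [← mul_assoc, hhalf, hddef, mul_smul_comm, smul_smul]; norm_num
    rw [h5, ← mul_add, add_halves] at h4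
    refine h4.mono ?_
    rw [hZ, Real.mul_rpow (x := kyFanConst β * C) (by positivity) hM.le]
    calc _ ≤ ‖(2 : ℂ)‖ * (2 * (2 * M ^ (θ / 2) * (2 * (kyFanConst β * C) ^ (θ / 2)))) := by
          gcongr
          · exact two_rpow_le_two hbt
          · exact two_rpow_le_two hbt2
      _ = _ := by norm_num; ring
  have hdiff : WeakDecay (β * θ) (64 * Z) (R ^ θ - star c * R ^ θ * c) := by
    rw [rpow_sub_star_mul_rpow_mul_eq c _ (isSelfAdjoint_rpow R θ)]
    have h3 : WeakDecay (β * θ) (16 * Z) (star c * (R ^ θ * (1 - c))) :=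
      (hQc.mul_left (star c)).mono (mul_le_of_le_one_left (by positivity) (by rwa [norm_star]))
    refine ((hQc.star (by positivity)).add h3).mono ?_
    calc _ ≤ 2 * (16 * Z + 16 * Z) := by gcongr; exact two_rpow_le_two hbt
      _ = _ := by ring
  -- Hansen's inequality for c, so that 0 ≤ R^θ - T^θ ≤ R^θ - c*R^θ c, and the right side has just
  -- been estimated.
  have hle : star c * R ^ θ * c ≤ T ^ θ := by
    have := star_mul_rpow_mul_le hR0 hc1 h0 h1
    rwa [hcRc] at this
  refine (hdiff.of_nonneg_of_le (by positivity)
    (sub_nonneg.2 (CFC.rpow_le_rpow ⟨h0.le, h1.le⟩ hTR)) (sub_le_sub_left hle _)).mono ?_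
  calc _ ≤ 2 * (64 * Z) := by gcongr; exact two_rpow_le_two hbt
    _ = _ := by ring

/-- Fractional powers are uniformly continuous for the weak quasi-norms. -/
theorem weakDecay_rpow_sub_rpow (hS : 0 ≤ S) (hT : 0 ≤ T) (hβ0 : 0 < β) (hβ : β < 1)
    (h0 : 0 < θ) (h1 : θ < 1) (hM : 0 < M) (hC : 0 < C) (hTM : WeakDecay β M T)
    (hd : WeakDecay β C (S - T)) :
    WeakDecay (β * θ) (512 * (kyFanConst β * (4 * C) * (2 * (M + C))) ^ (θ / 2))
      (S ^ θ - T ^ θ) := by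
  have hk := kyFanConst_pos hβ
  have hST : IsSelfAdjoint (S - T) := (IsSelfAdjoint.of_nonneg hS).sub (IsSelfAdjoint.of_nonneg hT)
  have h2 := two_rpow_le_two hβ.le
  have hbt : β * θ ≤ 1 := by nlinarith
  -- R dominates both S and T and is close to both, which reduces to comparable pairs.
  set R := T + CFC.abs (S - T) with hR
  have hRM : WeakDecay β (2 * (M + C)) R := (hTM.add hd.abs).mono (by gcongr)
  have hTR : T ≤ R := le_add_of_nonneg_right (CFC.abs_nonneg _)
  have hSR : S ≤ R := by
    rw [hR, ← sub_le_iff_le_add']; exact self_le_abs hST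
  have hRT : WeakDecay β (4 * C) (R - T) := by
    rw [hR, add_sub_cancel_left]; exact hd.abs.mono (by linarith)
  have hRS : WeakDecay β (4 * C) (R - S) := by
    have : R - S = CFC.abs (S - T) - (S - T) := by rw [hR]; abel
    rw [this]
    refine (hd.abs.sub hd).mono ?_
    calc _ ≤ 2 * (C + C) := by gcongr
      _ = _ := by ring
  have e1 := weakDecay_rpow_sub_rpow_of_le hT hTR hβ0 hβ h0 h1 (by positivity) (by positivity)
    hRM hRT
  have e2 := weakDecay_rpow_sub_rpow_of_le hS hSR hβ0 hβ h0 h1 (by positivity) (by positivity)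
    hRM hRS
  have e3 := e1.sub e2
  rw [sub_sub_sub_cancel_left] at e3
  refine e3.mono ?_
  calc _ ≤ 2 * (128 * (kyFanConst β * (4 * C) * (2 * (M + C))) ^ (θ / 2) +
        128 * (kyFanConst β * (4 * C) * (2 * (M + C))) ^ (θ / 2)) := by
        gcongr; exact two_rpow_le_two hbt
    _ = _ := by ring

theorem tendsto_rpow_sub_rpow_const (k M : ℝ) (h0 : 0 < θ) :
    Tendsto (fun C : ℝ => 512 * (k * (4 * C) * (2 * (M + C))) ^ (θ / 2)) (𝓝[>] 0) (𝓝 0) := by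
  have hc : Continuous (fun C : ℝ => 512 * (k * (4 * C) * (2 * (M + C))) ^ (θ / 2)) :=
    continuous_const.mul ((by fun_prop : Continuous fun C : ℝ =>
      k * (4 * C) * (2 * (M + C))).rpow_const fun x => Or.inr (by positivity))
  have := hc.tendsto 0
  simp only [mul_zero, zero_mul, Real.zero_rpow (half_pos h0).ne'] at this
  exact this.mono_left nhdsWithin_le_nhds

theorem exists_pos_weakDecay_rpow_sub_rpow (hβ0 : 0 < β) (hβ : β < 1)
    (h0 : 0 < θ) (h1 : θ < 1) (hT : 0 ≤ T) (hTb : WeakBdd β T) {ε : ℝ} (hε : 0 < ε) :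
    ∃ δ > 0, ∀ S : H →L[ℂ] H, 0 ≤ S → WeakDecay β δ (S - T) →
      WeakDecay (β * θ) ε (S ^ θ - T ^ θ) := by
  obtain ⟨M, hM, hTM⟩ := hTb
  obtain ⟨δ, hδ1, hδ⟩ := (((tendsto_rpow_sub_rpow_const (kyFanConst β) M h0).eventually_lt_const
    hε).and self_mem_nhdsWithin).exists
  exact ⟨δ, hδ, fun S hS hd =>
    (weakDecay_rpow_sub_rpow hS hT hβ0 hβ h0 h1 hM hδ hTM hd).mono hδ1.le⟩

theorem Negl.rpow_sub_rpow (hS : 0 ≤ S) (hT : 0 ≤ T) (hβ0 : 0 < β) (hβ : β < 1)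
    (h0 : 0 < θ) (h1 : θ < 1) (hTb : WeakBdd β T) (h : Negl β (S - T)) :
    Negl (β * θ) (S ^ θ - T ^ θ) := fun ε hε => by
  obtain ⟨δ, hδ, h2⟩ := exists_pos_weakDecay_rpow_sub_rpow hβ0 hβ h0 h1 hT hTb hε
  exact h2 S hS (h δ hδ)

end

/-! ### Commutators with fractional powers -/

section
variable {S T R c A B x : H →L[ℂ] H} {α β C D M θ : ℝ}

theorem weakDecay_commutator (hB : WeakDecay α M B) (hM : 0 ≤ M) (x : H →L[ℂ] H) :
    WeakDecay α (2 ^ α * (2 * M * ‖x‖)) (x * B - B * x) := by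
  convert (hB.mul_left x).sub (hB.mul_right hM x) using 1
  ring

/-- The operators commuting with `B` up to negligible operators. -/
def negligibleCommutant (α : ℝ) (B : H →L[ℂ] H) (hB : IsSelfAdjoint B) :
    StarSubalgebra ℂ (H →L[ℂ] H) where
  carrier := {x | Negl α (x * B - B * x)}
  mul_mem' {x y} hx hy := by
    have : x * y * B - B * (x * y) = x * (y * B - B * y) + (x * B - B * x) * y := by
      noncomm_ring
    simp only [Set.mem_ofPred_eq, this]
    exact (hy.mul_left x).add (hx.mul_right y)
  add_mem' {x y} hx hy := by
    have : (x + y) * B - B * (x + y) = (x * B - B * x) + (y * B - B * y) := by noncomm_ring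
    simp only [Set.mem_ofPred_eq, this]
    exact hx.add hy
  algebraMap_mem' r := by
    simp only [Set.mem_ofPred_eq, Algebra.commutes r B, sub_self]
    exact Negl.zero
  star_mem' {x} hx := by
    have : star x * B - B * star x = -star (x * B - B * x) := by
      rw [star_sub, star_mul, star_mul, hB.star_eq]; abel
    change Negl α (star x * B - B * star x)
    rw [this]
    exact hx.star.neg

/-- The commutator with B is continuous from the operator norm to the weak quasi-norm. Closedness
lets `cfc_mem` keep the functional calculus inside the algebra. -/
theorem isClosed_negligibleCommutant (hB : IsSelfAdjoint B) (hBb : WeakBdd α B) :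
    IsClosed (negligibleCommutant α B hB : Set (H →L[ℂ] H)) := by
  obtain ⟨M, hM, hBM⟩ := hBb
  refine isClosed_of_closure_subset fun x hx => ?_
  intro C hC
  have hpos : 0 < C / 2 ^ α / 2 / 2 ^ α / (2 * M) := by positivity
  obtain ⟨y, hy, hxy⟩ := Metric.mem_closure_iff.1 hx _ hpos
  have h1 : Negl α (y * B - B * y) := hy
  have e : x * B - B * x = ((x - y) * B - B * (x - y)) + (y * B - B * y) := by noncomm_ring
  rw [e]
  refine ((weakDecay_commutator hBM hM.le (x - y)).add (h1 (C / 2 ^ α / 2) (by positivity))).mono ?_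
  rw [dist_eq_norm] at hxy
  calc _ ≤ 2 ^ α * (2 ^ α * (2 * M * (C / 2 ^ α / 2 / 2 ^ α / (2 * M))) + C / 2 ^ α / 2) := by
        gcongr
    _ = C := by field_simp; ring

theorem unitary_conj_rpow (hB : 0 ≤ B) (u : unitary (H →L[ℂ] H)) (hθ : 0 ≤ θ) :
    ((u : H →L[ℂ] H) * B * star (u : H →L[ℂ] H)) ^ θ = u * B ^ θ * star (u : H →L[ℂ] H) := by
  have h1 : 0 ≤ (u : H →L[ℂ] H) * B * star (u : H →L[ℂ] H) := star_right_conjugate_nonneg hB _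
  rw [CFC.rpow_eq_cfc_real h1, CFC.rpow_eq_cfc_real hB]
  have hφ : Continuous (Unitary.conjStarAlgAut ℂ (H →L[ℂ] H) u) := by
    change Continuous fun x : H →L[ℂ] H => (u : H →L[ℂ] H) * x * star (u : H →L[ℂ] H)
    fun_prop
  have := StarAlgHomClass.map_cfc (S := ℂ) (Unitary.conjStarAlgAut ℂ (H →L[ℂ] H) u)
    (fun x : ℝ => x ^ θ) B (Real.continuous_rpow_const hθ).continuousOn hφ
    (IsSelfAdjoint.of_nonneg hB) (IsSelfAdjoint.of_nonneg h1)
  exact this.symm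

/-- For a unitary, [u, B] = (uBu* - B)u, and conjugation by u commutes with powers, so continuity of
the power applies. -/
theorem unitary_mem_negligibleCommutant_rpow (hα0 : 0 < α) (hα : α < 1) (hB : 0 ≤ B)
    (hBb : WeakBdd α B) (h0 : 0 < θ) (h1 : θ < 1) (u : unitary (H →L[ℂ] H))
    (hu : Negl α ((u : H →L[ℂ] H) * B - B * (u : H →L[ℂ] H))) :
    Negl (α * θ) ((u : H →L[ℂ] H) * B ^ θ - B ^ θ * (u : H →L[ℂ] H)) := by
  have huu : (u : H →L[ℂ] H) * star (u : H →L[ℂ] H) = 1 := Unitary.mul_star_self_of_mem u.2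
  have huu' : star (u : H →L[ℂ] H) * (u : H →L[ℂ] H) = 1 := Unitary.star_mul_self_of_mem u.2
  have h2 : Negl α ((u : H →L[ℂ] H) * B * star (u : H →L[ℂ] H) - B) := by
    have := hu.mul_right (star (u : H →L[ℂ] H))
    rwa [sub_mul, mul_assoc B, huu, mul_one] at this
  have h3 := (h2.rpow_sub_rpow (star_right_conjugate_nonneg hB _) hB hα0 hα h0 h1 hBb).mul_right u
  rwa [unitary_conj_rpow hB u h0.le, sub_mul, mul_assoc, huu', mul_one] at h3

/-- After rescaling to a contraction y, the unitary y + i(1 - y²)^{1/2} lies in the negligible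
commutant of B, hence in that of B^θ; so does its real part y. -/
theorem negl_commutator_rpow_of_isSelfAdjoint (hα0 : 0 < α) (hα : α < 1) (hB : 0 ≤ B)
    (hBb : WeakBdd α B) (h0 : 0 < θ) (h1 : θ ≤ 1) (hx : IsSelfAdjoint x)
    (h : Negl α (x * B - B * x)) : Negl (α * θ) (x * B ^ θ - B ^ θ * x) := by
  rcases h1.eq_or_lt with rfl | h1
  · rwa [CFC.rpow_one B hB, mul_one]
  have hBs := IsSelfAdjoint.of_nonneg hB
  set N := negligibleCommutant α B hBs with hN
  have : IsClosed (N : Set (H →L[ℂ] H)) := isClosed_negligibleCommutant hBs hBb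
  set r : ℝ := (‖x‖ + 1)⁻¹ with hr
  set y : H →L[ℂ] H := (r : ℂ) • x with hy
  have hys : IsSelfAdjoint y := by
    rw [hy, isSelfAdjoint_iff, star_smul, hx.star_eq]; simp
  have hy1 : ‖y‖ ≤ 1 := by
    rw [hy, norm_smul, Complex.norm_real, Real.norm_of_nonneg (by positivity), hr,
      inv_mul_le_iff₀ (by positivity)]
    linarith
  have hyN : y ∈ N := N.smul_mem h _
  set q : H →L[ℂ] H := CFC.sqrt (1 - y ^ 2) with hq
  have hqN : q ∈ N := by
    have h2 : (1 : H →L[ℂ] H) - y ^ 2 ∈ N := N.sub_mem N.one_mem (N.pow_mem hyN 2)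
    have h3 : 0 ≤ (1 : H →L[ℂ] H) - y ^ 2 := by
      have h4 : y ^ 2 = star y * y := by rw [hys.star_eq, sq]
      rw [sub_nonneg]
      refine le_of_re_inner_le (hys.pow 2) (IsSelfAdjoint.one _) fun z => ?_
      rw [h4, re_inner_star_mul_self, one_apply_eq_self, inner_self_eq_norm_sq]
      gcongr
      simpa using y.le_of_opNorm_le hy1 z
    rw [hq, CFC.sqrt_eq_real_sqrt _ h3, cfcₙ_eq_cfc]
    exact cfc_mem _ h2
  let u := selfAdjoint.unitarySelfAddISMul ⟨y, hys⟩ hy1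
  have hu : (u : H →L[ℂ] H) = y + Complex.I • q := rfl
  have hus : star (u : H →L[ℂ] H) = y - Complex.I • q :=
    selfAdjoint.star_coe_unitarySelfAddISMul _ _
  have huN : (u : H →L[ℂ] H) ∈ N := by
    rw [hu]; exact N.add_mem hyN (N.smul_mem hqN _)
  have h2 : (u : H →L[ℂ] H) ∈ negligibleCommutant (α * θ) (B ^ θ) (isSelfAdjoint_rpow B θ) :=
    unitary_mem_negligibleCommutant_rpow hα0 hα hB hBb h0 h1 u huN
  have h3 := add_mem h2 (star_mem h2)
  rw [hus, hu] at h3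
  have h4 : x = ((2 * r)⁻¹ : ℂ) • (y + Complex.I • q + (y - Complex.I • q)) := by
    have hr0 : (r : ℂ) ≠ 0 := by
      have : r ≠ 0 := by positivity
      exact_mod_cast this
    rw [add_add_sub_cancel, hy, ← two_smul ℂ, smul_smul, smul_smul, mul_assoc,
      inv_mul_cancel₀ (by simpa using hr0), one_smul]
  have h5 := (negligibleCommutant (α * θ) (B ^ θ) (isSelfAdjoint_rpow B θ)).smul_mem h3
    ((2 * r)⁻¹ : ℂ)
  rw [← h4] at h5
  exact h5

theorem negl_commutator_rpow_rpow (hα0 : 0 < α) (hα : α < 1) (hA : 0 ≤ A) (hB : 0 ≤ B)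
    (hBb : WeakBdd α B) (h : Negl α (A * B - B * A)) (h0 : 0 < θ) (h1 : θ ≤ 1)
    (s : ℝ) : Negl (α * θ) (A ^ s * B ^ θ - B ^ θ * A ^ s) := by
  have hBs := IsSelfAdjoint.of_nonneg hB
  refine negl_commutator_rpow_of_isSelfAdjoint hα0 hα hB hBb h0 h1 (isSelfAdjoint_rpow A s) ?_
  have : IsClosed (negligibleCommutant α B hBs : Set (H →L[ℂ] H)) :=
    isClosed_negligibleCommutant hBs hBb
  have h2 : A ^ s ∈ negligibleCommutant α B hBs := by
    rw [CFC.rpow_eq_cfc_real hA]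
    exact cfc_mem _ h
  exact h2

end

/-! ### Dyadic powers and small exponents -/

section
variable {A B X : H →L[ℂ] H} {α γ θ K M η : ℝ}

/-- B^{γ/2} A^{γ/2} need not be positive, so it is replaced by T = A^{γ/4} B^{γ/2} A^{γ/4}, equal to
it up to a commutator. Then T² and X^γ agree up to a negligible operator, and so do their positive
square roots. -/
theorem negl_rpow_half_sub (hα0 : 0 < α) (hα : α < 1) (hA : 0 ≤ A) (hB : 0 ≤ B) (hX : 0 ≤ X)
    (hBb : WeakBdd α B) (hXb : WeakBdd α X) (hAB : Negl α (A * B - B * A)) (h0 : 0 < γ)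
    (h1 : γ ≤ 1) (h : Negl (α * γ) (X ^ γ - B ^ γ * A ^ γ)) :
    Negl (α * (γ / 2)) (X ^ (γ / 2) - B ^ (γ / 2) * A ^ (γ / 2)) := by
  have hγ2 : 0 < γ / 2 := by positivity
  have hγ21 : γ / 2 ≤ 1 := by linarith
  have hγ : α * (γ / 2) + α * (γ / 2) = α * γ := by ring
  set q := A ^ (γ / 4) with hq
  set b := B ^ (γ / 2) with hb
  set Q := A ^ (γ / 2) with hQ
  have hq0 : 0 ≤ q := CFC.rpow_nonneg
  have hqs := IsSelfAdjoint.of_nonneg hq0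
  have hqq : q * q = Q := by
    rw [hq, hQ, rpow_mul_rpow hA (by positivity) (by positivity)]; congr 1; ring
  have hbb : b * b = B ^ γ := by rw [hb, rpow_mul_rpow hB hγ2.le hγ2.le, add_halves]
  have hQQ : Q * Q = A ^ γ := by rw [hQ, rpow_mul_rpow hA hγ2.le hγ2.le, add_halves]
  have hXX : X ^ (γ / 2) * X ^ (γ / 2) = X ^ γ := by
    rw [rpow_mul_rpow hX hγ2.le hγ2.le, add_halves]
  have hbw : WeakBdd (α * (γ / 2)) b := hBb.rpow hB hγ2 hγ21
  have hqb : Negl (α * (γ / 2)) (q * b - b * q) :=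
    negl_commutator_rpow_rpow hα0 hα hA hB hBb hAB hγ2 hγ21 _
  have hQb : Negl (α * (γ / 2)) (Q * b - b * Q) :=
    negl_commutator_rpow_rpow hα0 hα hA hB hBb hAB hγ2 hγ21 _
  set T := q * b * q with hT
  have hT0 : 0 ≤ T := by
    have := star_left_conjugate_nonneg (CFC.rpow_nonneg : 0 ≤ b) q
    rwa [hqs.star_eq] at this
  have hTb : Negl (α * (γ / 2)) (T - b * Q) := by
    have : T - b * Q = (q * b - b * q) * q := by rw [hT, ← hqq]; noncomm_ring
    rw [this]; exact hqb.mul_right q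
  have hTw : WeakBdd (α * (γ / 2)) T := (hbw.mul_left q).mul_right q
  have hTT : Negl (α * γ) (T * T - B ^ γ * A ^ γ) := by
    have e1 := hTb.mul_sub_mul hTb (hbw.mul_right Q) hTw
    have e2 : Negl (α * (γ / 2) + α * (γ / 2)) (b * Q * (b * Q) - b * b * (Q * Q)) := by
      have : b * Q * (b * Q) - b * b * (Q * Q) = (b * (Q * b - b * Q)) * Q := by noncomm_ring
      rw [this]; exact (Negl.mul' hbw hQb).mul_right Q
    have e3 := e1.trans e2
    rwa [hγ, hbb, hQQ] at e3
  have hXw : WeakBdd (α * (γ / 2)) (X ^ (γ / 2)) := hXb.rpow hX hγ2 hγ21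
  have key : Negl (α * γ / 2) (X ^ (γ / 2) - T) :=
    Negl.sub_of_mul_self_sub CFC.rpow_nonneg hT0 (by positivity) (by nlinarith)
      (mul_pos hα0 hγ2) (hXw.sub hTw) (by rw [hXX]; exact h.trans hTT.symm)
  rw [mul_div_assoc] at key
  exact key.trans hTb

theorem negl_rpow_two_pow_sub (hα0 : 0 < α) (hα : α < 1) (hA : 0 ≤ A) (hB : 0 ≤ B) (hX : 0 ≤ X)
    (hBb : WeakBdd α B) (hXb : WeakBdd α X) (hAB : Negl α (A * B - B * A))
    (h : Negl α (X - B * A)) (k : ℕ) :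
    Negl (α * (1 / 2) ^ k) (X ^ ((1 / 2 : ℝ) ^ k) - B ^ ((1 / 2 : ℝ) ^ k) * A ^ ((1 / 2 : ℝ) ^ k)) := by
  induction k with
  | zero =>
    simp only [pow_zero, mul_one, CFC.rpow_one A hA, CFC.rpow_one B hB, CFC.rpow_one X hX]
    exact h
  | succ k ih =>
    have := negl_rpow_half_sub hα0 hα hA hB hX hBb hXb hAB (by positivity)
      (pow_le_one₀ (by norm_num) (by norm_num)) ih
    rwa [show (1 / 2 : ℝ) ^ k / 2 = (1 / 2) ^ (k + 1) by rw [pow_succ]; ring] at this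

theorem weakBdd_rpow_nat_mul (hB : 0 ≤ B) (h0 : 0 < γ) (hb : WeakBdd (α * γ) (B ^ γ)) (m : ℕ) :
    WeakBdd (α * ((m + 1 : ℕ) * γ)) (B ^ (((m + 1 : ℕ) : ℝ) * γ)) := by
  induction m with
  | zero => simpa using hb
  | succ m ih =>
    have := ih.mul hb
    rw [rpow_mul_rpow hB (by positivity) h0.le] at this
    convert this using 1
    · push_cast; ring
    · congr 1; push_cast; ring

theorem negl_rpow_nat_mul_sub (hA : 0 ≤ A) (hB : 0 ≤ B) (hX : 0 ≤ X) (h0 : 0 < γ)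
    (hBb : WeakBdd (α * γ) (B ^ γ)) (hXb : WeakBdd (α * γ) (X ^ γ))
    (hAB : ∀ s : ℝ, Negl (α * γ) (A ^ s * B ^ γ - B ^ γ * A ^ s))
    (h : Negl (α * γ) (X ^ γ - B ^ γ * A ^ γ)) (m : ℕ) :
    Negl (α * ((m + 1 : ℕ) * γ)) (X ^ (((m + 1 : ℕ) : ℝ) * γ) -
      B ^ (((m + 1 : ℕ) : ℝ) * γ) * A ^ (((m + 1 : ℕ) : ℝ) * γ)) := by
  induction m with
  | zero => simpa using h
  | succ m ih =>
    have hBm := weakBdd_rpow_nat_mul hB h0 hBb m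
    set s : ℝ := ((m + 1 : ℕ) : ℝ) * γ with hs
    have hs0 : 0 ≤ s := by positivity
    have hs' : ((m + 1 + 1 : ℕ) : ℝ) * γ = s + γ := by rw [hs]; push_cast; ring
    rw [hs', ← rpow_mul_rpow hX hs0 h0.le, ← rpow_mul_rpow hA hs0 h0.le,
      ← rpow_mul_rpow hB hs0 h0.le, mul_add]
    have e1 := ih.mul_sub_mul h (hBm.mul_right _) hXb
    refine e1.trans ?_
    have : B ^ s * A ^ s * (B ^ γ * A ^ γ) - B ^ s * B ^ γ * (A ^ s * A ^ γ) =
        (B ^ s * (A ^ s * B ^ γ - B ^ γ * A ^ s)) * A ^ γ := by noncomm_ring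
    rw [this]
    exact (Negl.mul' hBm (hAB s)).mul_right _

theorem smul_rpow (hB : 0 ≤ B) (hK : 0 ≤ K) (hη : 0 ≤ η) : (K • B) ^ η = K ^ η • B ^ η := by
  have hc := Real.continuous_rpow_const hη
  rw [CFC.rpow_eq_cfc_real (smul_nonneg hK hB), CFC.rpow_eq_cfc_real hB,
    ← cfc_comp_smul K (fun x : ℝ => x ^ η) B hc.continuousOn, ← cfc_smul _ _ _ hc.continuousOn]
  exact cfc_congr fun x hx => by
    simp only [smul_eq_mul]
    exact Real.mul_rpow hK (spectrum_nonneg hB hx)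

theorem rpow_le_one_add (hM : 0 ≤ M) (hη : 0 ≤ η) (hη1 : η ≤ 1) : M ^ η ≤ M + 1 := by
  rcases le_total M 1 with h | h
  · exact (Real.rpow_le_one hM h hη).trans (by linarith)
  · calc M ^ η ≤ M ^ (1 : ℝ) := Real.rpow_le_rpow_of_exponent_le h hη1
      _ ≤ M + 1 := by rw [Real.rpow_one]; linarith

theorem weakDecay_rpow_le_one_add (hα0 : 0 < α) (hα : α < 1) (hB : 0 ≤ B) (hM : 0 < M)
    (hBM : WeakDecay α M B) (hη : 0 < η) (hη1 : η ≤ 1) :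
    WeakDecay (α * η) (2 * (M + 1)) (B ^ η) := by
  refine (hBM.rpow hB hM hη hη1).mono ?_
  gcongr
  · exact two_rpow_le_two (by nlinarith)
  · exact rpow_le_one_add hM.le hη.le hη1

/-- Powers with small exponents of comparable operators are close. -/
theorem weakDecay_rpow_sub_rpow_of_comparable {W : H →L[ℂ] H} (hα0 : 0 < α) (hα : α < 1)
    (hB : 0 ≤ B) (hM : 0 < M) (hBM : WeakDecay α M B) (hK : 1 ≤ K) (h1 : K⁻¹ • B ≤ W)
    (h2 : W ≤ K • B) (hη : 0 < η) (hη1 : η ≤ 1) :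
    WeakDecay (α * η) (36 * (K ^ η - 1) * (M + 1)) (W ^ η - B ^ η) := by
  have hK0 : 0 < K := by linarith
  have hW : 0 ≤ W := (smul_nonneg (by positivity) hB).trans h1
  have hKη : 1 ≤ K ^ η := Real.one_le_rpow hK hη.le
  have hB' : 0 ≤ B ^ η := CFC.rpow_nonneg
  have u1 : W ^ η ≤ K ^ η • B ^ η := by
    rw [← smul_rpow hB hK0.le hη.le]; exact CFC.rpow_le_rpow ⟨hη.le, hη1⟩ h2
  have l1 : (K⁻¹) ^ η • B ^ η ≤ W ^ η := by
    rw [← smul_rpow hB (by positivity) hη.le]; exact CFC.rpow_le_rpow ⟨hη.le, hη1⟩ h1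
  -- By operator monotonicity of powers up to 1, W^η - B^η lies between ±(K^η - 1)B^η.
  have hR : WeakDecay (α * η) ((K ^ η - 1) * (2 * (M + 1))) ((K ^ η - 1) • B ^ η) := by
    have := (weakDecay_rpow_le_one_add hα0 hα hB hM hBM hη hη1).smul ((K ^ η - 1 : ℝ) : ℂ)
    rwa [Complex.coe_smul, Complex.norm_real, Real.norm_of_nonneg (by linarith)] at this
  have hpos : 0 ≤ (K ^ η - 1) * (2 * (M + 1)) := mul_nonneg (by linarith) (by positivity)
  have hinv : 1 - (K⁻¹) ^ η ≤ K ^ η - 1 := by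
    rw [Real.inv_rpow hK0.le]
    have h3 : K ^ η * (K ^ η)⁻¹ = 1 := mul_inv_cancel₀ (by positivity)
    nlinarith [sq_nonneg (K ^ η - 1), inv_pos.2 (show 0 < K ^ η by positivity)]
  refine (hR.of_neg_le_of_le hpos ?_ ?_).mono ?_
  · have h4 : (1 - (K⁻¹) ^ η) • B ^ η ≤ (K ^ η - 1) • B ^ η := smul_le_smul_of_nonneg_right hinv hB'
    rw [sub_smul, one_smul] at h4
    calc -((K ^ η - 1) • B ^ η) ≤ -(B ^ η - (K⁻¹) ^ η • B ^ η) := neg_le_neg h4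
      _ = (K⁻¹) ^ η • B ^ η - B ^ η := neg_sub _ _
      _ ≤ _ := sub_le_sub_right l1 _
  · rw [sub_smul, one_smul]; exact sub_le_sub_right u1 _
  · have h2 : (2 : ℝ) ^ (α * η) ≤ 2 := two_rpow_le_two (by nlinarith)
    set z := (K ^ η - 1) * (2 * (M + 1)) with hz
    calc _ ≤ 2 * (2 * (2 * (z + z)) + z) := by gcongr
      _ = _ := by rw [hz]; ring

theorem norm_rpow_sub_rpow_le (hA : 0 ≤ A) (hK : 1 ≤ K)
    (h1 : ∀ x ∈ spectrum ℝ A, K⁻¹ ≤ x ∧ x ≤ K) (hη : 0 < η) (hηθ : η < θ) (hθ : θ ≤ 1) :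
    ‖A ^ (θ - η) - A ^ θ‖ ≤ K * (K ^ η - 1) := by
  have hK0 : 0 < K := by linarith
  have hKη : 1 ≤ K ^ η := Real.one_le_rpow hK hη.le
  rw [CFC.rpow_eq_cfc_real hA, CFC.rpow_eq_cfc_real hA, ← cfc_sub _ _ _
    (Real.continuous_rpow_const (by linarith)).continuousOn
    (Real.continuous_rpow_const (by linarith)).continuousOn]
  refine norm_cfc_le (mul_nonneg hK0.le (by linarith)) fun x hx => ?_
  obtain ⟨hx1, hx2⟩ := h1 x hx
  have hx0 : 0 < x := lt_of_lt_of_le (by positivity) hx1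
  have e1 : x ^ θ = x ^ (θ - η) * x ^ η := by rw [← Real.rpow_add hx0]; ring_nf
  have e2 : x ^ (θ - η) ≤ K := by
    calc x ^ (θ - η) ≤ K ^ (θ - η) := Real.rpow_le_rpow hx0.le hx2 (by linarith)
      _ ≤ K ^ (1 : ℝ) := Real.rpow_le_rpow_of_exponent_le hK (by linarith)
      _ = K := Real.rpow_one K
  have e3 : x ^ η ≤ K ^ η := Real.rpow_le_rpow hx0.le hx2 hη.le
  have e4 : (K ^ η)⁻¹ ≤ x ^ η := by
    rw [← Real.inv_rpow hK0.le]; exact Real.rpow_le_rpow (by positivity) hx1 hη.le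
  have h3 : K ^ η * (K ^ η)⁻¹ = 1 := mul_inv_cancel₀ (by positivity)
  have e5 : |1 - x ^ η| ≤ K ^ η - 1 := by
    rw [abs_le]
    constructor
    · linarith
    · nlinarith [sq_nonneg (K ^ η - 1), inv_pos.2 (show 0 < K ^ η by positivity)]
  rw [e1, Real.norm_eq_abs, show x ^ (θ - η) - x ^ (θ - η) * x ^ η = x ^ (θ - η) * (1 - x ^ η) by
    ring, abs_mul, abs_of_nonneg (by positivity)]
  gcongr

theorem exists_dyadic_approx {δ : ℝ} (hδ : 0 < δ) (hθ : 0 < θ) :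
    ∃ (k m : ℕ), 0 < θ - ((m + 1 : ℕ) : ℝ) * (1 / 2) ^ k ∧
      θ - ((m + 1 : ℕ) : ℝ) * (1 / 2) ^ k ≤ δ := by
  obtain ⟨k, hk⟩ := exists_pow_lt_of_lt_one (lt_min hδ hθ) (by norm_num : (1 / 2 : ℝ) < 1)
  set g : ℝ := (1 / 2) ^ k with hg
  have hg0 : 0 < g := by positivity
  have hgδ : g < δ := hk.trans_le (min_le_left _ _)
  have hgθ : g < θ := hk.trans_le (min_le_right _ _)
  have h1 : 1 < ⌈θ / g⌉₊ := by
    rw [Nat.lt_ceil]; push_cast; rwa [lt_div_iff₀ hg0, one_mul]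
  -- One less than the ceiling, m + 1, is positive because g < θ, and leaves a strictly positive gap
  -- of at most g.
  obtain ⟨m, hm⟩ : ∃ m, ⌈θ / g⌉₊ = m + 2 := ⟨⌈θ / g⌉₊ - 2, by omega⟩
  have h2 := Nat.le_ceil (θ / g)
  have h3 := Nat.ceil_lt_add_one (show 0 ≤ θ / g by positivity)
  rw [hm] at h2 h3
  rw [div_le_iff₀ hg0] at h2
  rw [← sub_lt_iff_lt_add, lt_div_iff₀ hg0] at h3
  push_cast at h2 h3 ⊢
  exact ⟨k, m, by nlinarith, by nlinarith⟩

end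

/-! ### Arbitrary fractional powers -/

section
variable {A B X : H →L[ℂ] H} {α γ θ K M η : ℝ}

theorem exists_rpow_sub_one_le (hK : 1 ≤ K) {e : ℝ} (he : 0 < e) :
    ∃ δ : ℝ, 0 < δ ∧ δ ≤ 1 ∧ ∀ η ≤ δ, K ^ η - 1 ≤ e := by
  have hc : Tendsto (fun η : ℝ => K ^ η - 1) (𝓝[>] 0) (𝓝 0) := by
    have : Continuous fun η : ℝ => K ^ η - 1 :=
      (Real.continuous_const_rpow (by linarith)).sub continuous_const
    have h := this.tendsto 0
    simp only [Real.rpow_zero, sub_self] at h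
    exact h.mono_left nhdsWithin_le_nhds
  obtain ⟨δ, h1, h2⟩ := ((hc.eventually_lt_const he).and
    (Ioc_mem_nhdsGT (zero_lt_one : (0 : ℝ) < 1))).exists
  exact ⟨δ, h2.1, h2.2, fun η hη =>
    (sub_le_sub_right (Real.rpow_le_rpow_of_exponent_le hK hη) 1).trans h1.le⟩

/-- Fractional powers of `X ≈ B A` when `A` is invertible. -/
theorem negl_rpow_sub_of_comparable (hα0 : 0 < α) (hα : α < 1) (hB : 0 ≤ B) (hX : 0 ≤ X)
    (hBb : WeakBdd α B) (hAB : Negl α (A * B - B * A)) (h : Negl α (X - B * A)) (hK : 1 ≤ K)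
    (hA1 : K⁻¹ • (1 : H →L[ℂ] H) ≤ A) (hA2 : A ≤ K • (1 : H →L[ℂ] H))
    (h0 : 0 < θ) (h1 : θ < 1) : Negl (α * θ) (X ^ θ - B ^ θ * A ^ θ) := by
  have hK0 : 0 < K := by linarith
  have hA : 0 ≤ A := (smul_nonneg (by positivity) zero_le_one).trans hA1
  have hsp : ∀ x ∈ spectrum ℝ A, K⁻¹ ≤ x ∧ x ≤ K := fun x hx => by
    have hAs := IsSelfAdjoint.of_nonneg hA
    rw [← Algebra.algebraMap_eq_smul_one] at hA1 hA2
    exact ⟨(algebraMap_le_iff_le_spectrum hAs).1 hA1 x hx,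
      (le_algebraMap_iff_spectrum_le hAs).1 hA2 x hx⟩
  have hXb : WeakBdd α X := h.weakBdd_of_sub (hBb.mul_right A)
  obtain ⟨M, hM, hBM⟩ := id hBb
  -- the comparable operator `W`
  set b := CFC.sqrt B with hb
  have hbs : star b = b := (IsSelfAdjoint.of_nonneg (CFC.sqrt_nonneg B)).star_eq
  have hbb : b * b = B := CFC.sqrt_mul_sqrt_self B hB
  set W := b * A * b with hW
  have hconj : ∀ c : ℝ, b * (c • (1 : H →L[ℂ] H)) * b = c • B := fun c => by
    rw [mul_smul_comm, mul_one, smul_mul_assoc, hbb]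
  have hW1 : K⁻¹ • B ≤ W := by
    have := star_left_conjugate_le_conjugate hA1 b
    rwa [hbs, hconj] at this
  have hW2 : W ≤ K • B := by
    have := star_left_conjugate_le_conjugate hA2 b
    rwa [hbs, hconj] at this
  have hW0 : 0 ≤ W := (smul_nonneg (by positivity) hB).trans hW1
  -- W - BA = B^{1/2}[A, B^{1/2}]. Unlike X, W is comparable with B in the operator order.
  have hXW : Negl α (X - W) := by
    have hbw : WeakBdd (α * (1 / 2)) b := by
      rw [hb, CFC.sqrt_eq_rpow]; exact hBb.rpow hB (by norm_num) (by norm_num)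
    have e1 : Negl (α * (1 / 2)) (A * b - b * A) := by
      have := negl_commutator_rpow_rpow hα0 hα hA hB hBb hAB (θ := 1 / 2) (by norm_num)
        (by norm_num) 1
      rwa [CFC.rpow_one A hA, ← CFC.sqrt_eq_rpow] at this
    have e2 := Negl.mul' hbw e1
    have e3 : b * (A * b - b * A) = W - B * A := by rw [hW, ← hbb]; noncomm_ring
    rw [e3, ← mul_add, add_halves, mul_one] at e2
    exact h.trans e2.symm
  have hWb : WeakBdd α W := hXW.symm.weakBdd_of_sub hXb
  intro ε hε
  -- Collects the constants of the two non-negligible errors `t3` and `t5`. They do not depend on η,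
  -- so η can be chosen afterwards to make these errors contribute at most ε/2.
  set L := 4 * (144 * K * (M + 1) ^ 2 + 2 * K * (M + 1)) with hL
  have hL0 : 0 < L := by positivity
  obtain ⟨δ, hδ0, hδ1, hδ⟩ := exists_rpow_sub_one_le hK (show 0 < ε / (2 * L) by positivity)
  obtain ⟨k, m, hη0, hηδ⟩ := exists_dyadic_approx hδ0 h0
  set g : ℝ := (1 / 2) ^ k with hg
  have hg0 : 0 < g := by positivity
  have hg1 : g ≤ 1 := pow_le_one₀ (by norm_num) (by norm_num)
  set s : ℝ := ((m + 1 : ℕ) : ℝ) * g with hs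
  have hs0 : 0 < s := by positivity
  set η := θ - s with hη
  have hη1 : η ≤ 1 := hηδ.trans hδ1
  have hsη : θ - η = s := by rw [hη]; ring
  have hηθ : η < θ := by linarith
  have hs1 : s ≤ 1 := by linarith
  have hsum : α * s + α * η = α * θ := by rw [hη]; ring
  have hbt : α * θ ≤ 1 := by nlinarith
  have hXs : Negl (α * s) (X ^ s - B ^ s * A ^ s) :=
    negl_rpow_nat_mul_sub hA hB hX hg0 (hBb.rpow hB hg0 hg1) (hXb.rpow hX hg0 hg1)
      (fun _ => negl_commutator_rpow_rpow hα0 hα hA hB hBb hAB hg0 hg1 _)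
      (negl_rpow_two_pow_sub hα0 hα hA hB hX hBb hXb hAB h k) m
  have hBs : WeakBdd (α * s) (B ^ s) := hBb.rpow hB hs0 hs1
  have t1 : Negl (α * θ) ((X ^ s - B ^ s * A ^ s) * X ^ η) := by
    rw [← hsum]; exact hXs.mul (hXb.rpow hX hη0 hη1)
  have t2 : Negl (α * θ) (B ^ s * A ^ s * (X ^ η - W ^ η)) := by
    rw [← hsum]
    exact Negl.mul' (hBs.mul_right _)
      (hXW.rpow_sub_rpow hX hW0 hα0 hα hη0 (by linarith) hWb)
  have t4 : Negl (α * θ) (B ^ s * (A ^ s * B ^ η - B ^ η * A ^ s)) := by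
    rw [← hsum]
    exact Negl.mul' hBs (negl_commutator_rpow_rpow hα0 hα hA hB hBb hAB hη0 hη1 _)
  have hE0 : 0 ≤ K ^ η - 1 := by linarith [Real.one_le_rpow hK hη0.le]
  have hAs : ‖A ^ s‖ ≤ K := by
    rw [CFC.rpow_eq_cfc_real hA]
    refine norm_cfc_le hK0.le fun x hx => ?_
    have hx0 := spectrum_nonneg hA hx
    rw [Real.norm_of_nonneg (by positivity)]
    calc x ^ s ≤ K ^ s := Real.rpow_le_rpow hx0 (hsp x hx).2 hs0.le
      _ ≤ K ^ (1 : ℝ) := Real.rpow_le_rpow_of_exponent_le hK hs1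
      _ = K := Real.rpow_one K
  have t3 : WeakDecay (α * θ) (144 * K * (M + 1) ^ 2 * (K ^ η - 1))
      (B ^ s * A ^ s * (W ^ η - B ^ η)) := by
    have e1 := (weakDecay_rpow_le_one_add hα0 hα hB hM hBM hs0 hs1).mul_right (by positivity) (A ^ s)
    have e2 := weakDecay_rpow_sub_rpow_of_comparable hα0 hα hB hM hBM hK hW1 hW2 hη0 hη1
    have e3 := e1.mul e2 (by positivity)
    rw [hsum] at e3
    refine e3.mono ?_
    calc _ ≤ 2 * (2 * (M + 1) * K * (36 * (K ^ η - 1) * (M + 1))) := by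
          gcongr; exact two_rpow_le_two hbt
      _ = _ := by ring
  have t5 : WeakDecay (α * θ) (2 * K * (M + 1) * (K ^ η - 1)) (B ^ θ * (A ^ s - A ^ θ)) := by
    have e1 := (weakDecay_rpow_le_one_add hα0 hα hB hM hBM h0 h1.le).mul_right (by positivity)
      (A ^ s - A ^ θ)
    refine e1.mono ?_
    have e2 := norm_rpow_sub_rpow_le hA hK hsp hη0 hηθ h1.le
    rw [hsη] at e2
    calc _ ≤ 2 * (M + 1) * (K * (K ^ η - 1)) := by gcongr
      _ = _ := by ring
  -- Telescoping along X^s X^η, B^s A^s X^η, B^s A^s W^η, B^s A^s B^η, B^θ A^s, B^θ A^θ.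
  have key : X ^ θ - B ^ θ * A ^ θ =
      (B ^ s * A ^ s * (W ^ η - B ^ η) + B ^ θ * (A ^ s - A ^ θ)) +
      ((X ^ s - B ^ s * A ^ s) * X ^ η + B ^ s * A ^ s * (X ^ η - W ^ η) +
        B ^ s * (A ^ s * B ^ η - B ^ η * A ^ s)) := by
    have e1 : X ^ θ = X ^ s * X ^ η := by
      rw [rpow_mul_rpow hX hs0.le hη0.le]; congr 1; rw [hη]; ring
    have e2 : B ^ θ = B ^ s * B ^ η := by
      rw [rpow_mul_rpow hB hs0.le hη0.le]; congr 1; rw [hη]; ring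
    rw [e1, e2]; noncomm_ring
  rw [key]
  refine ((t3.add t5).add (((t1.add t2).add t4) (ε / 4) (by positivity))).mono ?_
  have e1 := hδ η hηδ
  rw [le_div_iff₀ (by positivity)] at e1
  have e2 := two_rpow_le_two hbt
  calc _ ≤ 2 * (2 * (144 * K * (M + 1) ^ 2 * (K ^ η - 1) + 2 * K * (M + 1) * (K ^ η - 1)) + ε / 4) := by
        gcongr
    _ = (K ^ η - 1) * (2 * L) / 2 + ε / 2 := by rw [hL]; ring
    _ ≤ ε := by linarith

theorem negl_sqrt_mul_sqrt_sub (h : Negl α (CFC.sqrt A * B - B * CFC.sqrt A)) (hA : 0 ≤ A) :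
    Negl α (CFC.sqrt A * B * CFC.sqrt A - B * A) := by
  have : CFC.sqrt A * B * CFC.sqrt A - B * A =
      (CFC.sqrt A * B - B * CFC.sqrt A) * CFC.sqrt A := by
    conv_lhs => rw [← CFC.sqrt_mul_sqrt_self A hA, CFC.sqrt_mul_sqrt_self A hA]
    rw [sub_mul, mul_assoc B, CFC.sqrt_mul_sqrt_self A hA]
  rw [this]
  exact h.mul_right _

theorem negl_commutator_of_sqrt (h : Negl α (CFC.sqrt A * B - B * CFC.sqrt A)) (hA : 0 ≤ A) :
    Negl α (A * B - B * A) := by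
  have : A * B - B * A = CFC.sqrt A * (CFC.sqrt A * B - B * CFC.sqrt A) +
      (CFC.sqrt A * B - B * CFC.sqrt A) * CFC.sqrt A := by
    conv_lhs => rw [← CFC.sqrt_mul_sqrt_self A hA]
    noncomm_ring
  rw [this]
  exact (h.mul_left _).add (h.mul_right _)

theorem sqrt_mul_mul_sqrt_nonneg (hB : 0 ≤ B) (A : H →L[ℂ] H) :
    0 ≤ CFC.sqrt A * B * CFC.sqrt A := by
  have := star_left_conjugate_nonneg hB (CFC.sqrt A)
  rwa [(IsSelfAdjoint.of_nonneg (CFC.sqrt_nonneg A)).star_eq] at this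

theorem negl_sqrt_commutator_add_smul_one (hB : 0 ≤ B) (hBb : WeakBdd α B) (hA : 0 ≤ A)
    (h : Negl α (A * B - B * A)) {e : ℝ} (he : 0 ≤ e) :
    Negl α (CFC.sqrt (A + e • (1 : H →L[ℂ] H)) * B - B * CFC.sqrt (A + e • (1 : H →L[ℂ] H))) := by
  have hBs := IsSelfAdjoint.of_nonneg hB
  have : IsClosed (negligibleCommutant α B hBs : Set (H →L[ℂ] H)) :=
    isClosed_negligibleCommutant hBs hBb
  have h1 : A + e • (1 : H →L[ℂ] H) ∈ negligibleCommutant α B hBs := by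
    refine add_mem h ?_
    rw [← Complex.coe_smul]
    exact (negligibleCommutant α B hBs).smul_mem (one_mem _) _
  have h2 : CFC.sqrt (A + e • (1 : H →L[ℂ] H)) ∈ negligibleCommutant α B hBs := by
    rw [CFC.sqrt_eq_real_sqrt _ (add_nonneg hA (smul_nonneg he zero_le_one)), cfcₙ_eq_cfc]
    exact cfc_mem _ h1
  exact h2

theorem tendsto_rpow_add_smul_one (hA : 0 ≤ A) (h0 : 0 < θ) :
    Tendsto (fun e : ℝ => ‖(A + e • (1 : H →L[ℂ] H)) ^ θ - A ^ θ‖) (𝓝[>] 0) (𝓝 0) := by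
  lift θ to NNReal using h0.le
  have h0' : 0 < θ := by exact_mod_cast h0
  have h1 : Tendsto (fun e : ℝ => A + e • (1 : H →L[ℂ] H)) (𝓝[>] 0)
      (𝓝[{a : H →L[ℂ] H | 0 ≤ a}] A) := by
    refine tendsto_nhdsWithin_iff.2 ⟨?_, ?_⟩
    · have hc : Continuous fun e : ℝ => A + e • (1 : H →L[ℂ] H) := by fun_prop
      have := hc.tendsto 0
      rw [zero_smul, add_zero] at this
      exact this.mono_left nhdsWithin_le_nhds
    · filter_upwards [self_mem_nhdsWithin] with e he
      exact add_nonneg hA (smul_nonneg (le_of_lt he) zero_le_one)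
  have h2 := ((CFC.continuousOn_nnrpow (A := H →L[ℂ] H) θ) A hA).tendsto.comp h1
  simp only [← CFC.nnrpow_eq_rpow h0']
  exact (tendsto_iff_norm_sub_tendsto_zero).1 h2

/-- Fractional powers of `A ^ (1/2) B A ^ (1/2)`. -/
theorem negl_rpow_sub (hα0 : 0 < α) (hα : α < 1) (hA : 0 ≤ A) (hB : 0 ≤ B)
    (hBb : WeakBdd α B) (h : Negl α (CFC.sqrt A * B - B * CFC.sqrt A))
    (h0 : 0 < θ) (h1 : θ < 1) :
    Negl (α * θ) ((CFC.sqrt A * B * CFC.sqrt A) ^ θ - B ^ θ * A ^ θ) := by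
  intro ε hε
  have hbt : α * θ ≤ 1 := by nlinarith
  have hAB := negl_commutator_of_sqrt h hA
  obtain ⟨M, hM, hBM⟩ := id hBb
  set a := CFC.sqrt A with ha
  set X := a * B * a with hX
  have hX0 : 0 ≤ X := sqrt_mul_mul_sqrt_nonneg hB A
  have hXb : WeakBdd α X := (hBb.mul_left a).mul_right a
  obtain ⟨δ, hδ0, hδ⟩ := exists_pos_weakDecay_rpow_sub_rpow hα0 hα h0 h1 hX0 hXb
    (show 0 < ε / 8 by positivity)
  have l1 := tendsto_rpow_add_smul_one hA (show (0 : ℝ) < 1 / 2 by norm_num)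
  have l2 := tendsto_rpow_add_smul_one hA h0
  have l3 : 0 < min 1 (δ / (2 * (M * (2 * ‖a‖ + 1)))) := by positivity
  have l4 : 0 < ε / 16 / (2 * (M + 1)) := by positivity
  -- Both δ and the tolerances are fixed before e. The bound K below may blow up as e → 0; this is
  -- harmless, since the invertible case yields `Negl`, with no constant depending on K.
  obtain ⟨e, ⟨he1, he2⟩, he0⟩ := (((l1.eventually_lt_const l3).and
    (l2.eventually_lt_const l4)).and self_mem_nhdsWithin).exists
  have he0 : 0 < e := he0
  set A' := A + e • (1 : H →L[ℂ] H) with hA'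
  have hA'0 : 0 ≤ A' := add_nonneg hA (smul_nonneg he0.le zero_le_one)
  set a' := CFC.sqrt A' with ha'
  set X' := a' * B * a' with hX'
  have hX'0 : 0 ≤ X' := sqrt_mul_mul_sqrt_nonneg hB A'
  have hd := he1
  rw [← CFC.sqrt_eq_rpow, ← CFC.sqrt_eq_rpow, ← ha, ← ha', lt_min_iff] at hd
  have ha'n : ‖a'‖ ≤ ‖a‖ + 1 := by
    have := norm_sub_norm_le a' a
    linarith [hd.1]
  have h' : Negl α (a' * B - B * a') := negl_sqrt_commutator_add_smul_one hB hBb hA hAB he0.le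
  -- the invertible case
  set K := max 1 (max (‖A‖ + e) e⁻¹) with hK
  have hK1 : 1 ≤ K := le_max_left _ _
  have hKe : K⁻¹ ≤ e := by
    rw [inv_le_comm₀ (by positivity) he0]
    exact (le_max_right _ _).trans (le_max_right _ _)
  have hKA : ‖A‖ + e ≤ K := (le_max_left _ _).trans (le_max_right _ _)
  have c1 : K⁻¹ • (1 : H →L[ℂ] H) ≤ A' :=
    (smul_le_smul_of_nonneg_right hKe zero_le_one).trans (le_add_of_nonneg_left hA)
  have c2 : A' ≤ K • (1 : H →L[ℂ] H) := by
    have e1 : A ≤ ‖A‖ • (1 : H →L[ℂ] H) := by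
      rw [← Algebra.algebraMap_eq_smul_one]
      exact (IsSelfAdjoint.of_nonneg hA).le_algebraMap_norm_self
    refine (add_le_add_left e1 _).trans ?_
    rw [← add_smul]
    exact smul_le_smul_of_nonneg_right hKA zero_le_one
  have n1 : Negl (α * θ) (X' ^ θ - B ^ θ * A' ^ θ) :=
    negl_rpow_sub_of_comparable hα0 hα hB hX'0 hBb (negl_commutator_of_sqrt h' hA'0)
      (negl_sqrt_mul_sqrt_sub h' hA'0) hK1 c1 c2 h0 h1
  have w1 : WeakDecay α δ (X' - X) := by
    have e1 : X' - X = (a' - a) * (B * a') + (a * B) * (a' - a) := by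
      rw [hX, hX']; noncomm_ring
    rw [e1]
    refine (((hBM.mul_right hM.le a').mul_left (a' - a)).add
      ((hBM.mul_left a).mul_right (by positivity) (a' - a))).mono ?_
    have e2 := hd.2.le
    rw [le_div_iff₀ (by positivity)] at e2
    calc _ ≤ 2 * (‖a' - a‖ * (M * (‖a‖ + 1)) + ‖a‖ * M * ‖a' - a‖) := by
          gcongr; exact two_rpow_le_two hα.le
      _ = ‖a' - a‖ * (2 * (M * (2 * ‖a‖ + 1))) := by ring
      _ ≤ δ := e2
  have w2 : WeakDecay (α * θ) (ε / 8) (X' ^ θ - X ^ θ) := hδ X' hX'0 w1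
  have w3 : WeakDecay (α * θ) (ε / 16) (B ^ θ * (A' ^ θ - A ^ θ)) := by
    refine ((weakDecay_rpow_le_one_add hα0 hα hB hM hBM h0 h1.le).mul_right (by positivity)
      (A' ^ θ - A ^ θ)).mono ?_
    have e2 := he2.le
    rw [le_div_iff₀ (by positivity)] at e2
    linarith
  have key : X ^ θ - B ^ θ * A ^ θ =
      (X' ^ θ - B ^ θ * A' ^ θ) - (X' ^ θ - X ^ θ) + B ^ θ * (A' ^ θ - A ^ θ) := by
    noncomm_ring
  rw [key]
  refine (((n1 (ε / 16) (by positivity)).sub w2).add w3).mono ?_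
  have e2 := two_rpow_le_two hbt
  calc _ ≤ 2 * (2 * (ε / 16 + ε / 8) + ε / 16) := by gcongr
    _ ≤ ε := by linarith

end

end

/-! ### From exponent p/(m+1) to exponent p -/

theorem mainTheorem2 {H : Type*} [NormedAddCommGroup H] [InnerProductSpace ℂ H] [CompleteSpace H]
    [TopologicalSpace.SeparableSpace H] (p : ℝ) (hp : 1 < p)
    (A B : H →L[ℂ] H) (hA : 0 ≤ A) (hB : 0 ≤ B) (hBp : MemWeakSchatten p B)
    (hAB : MemWeakSchattenSep p (CFC.sqrt A * B - B * CFC.sqrt A)) :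
    MemWeakSchattenSep 1 (B ^ p * A ^ p - (CFC.sqrt A * B * CFC.sqrt A) ^ p) := by
  have hp0 : 0 < p := by linarith
  rw [memWeakSchatten_iff hp0] at hBp
  rw [memWeakSchattenSep_iff hp0] at hAB
  rw [memWeakSchattenSep_iff one_pos]
  have hα0 : 0 < 1 / p := by positivity
  have hα : 1 / p < 1 := by rw [div_lt_one hp0]; exact hp
  -- An integer above p makes θ = p/n < 1, the range of the fractional results; the n-fold product
  -- restores the exponent p, integer or not.
  obtain ⟨n, hn⟩ := exists_nat_gt p
  obtain ⟨m, rfl⟩ : ∃ m, n = m + 1 := ⟨n - 1, by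
    have : n ≠ 0 := by rintro rfl; norm_num at hn; linarith
    omega⟩
  set θ : ℝ := p / (m + 1 : ℕ) with hθ
  have h0 : 0 < θ := by positivity
  have h1 : θ < 1 := by rw [hθ, div_lt_one (by positivity)]; exact hn
  have hX := sqrt_mul_mul_sqrt_nonneg hB A
  have hXb : WeakBdd (1 / p) (CFC.sqrt A * B * CFC.sqrt A) := (hBp.mul_left _).mul_right _
  have key := negl_rpow_nat_mul_sub hA hB hX h0 (hBp.rpow hB h0 h1.le) (hXb.rpow hX h0 h1.le)
    (fun s => negl_commutator_rpow_rpow hα0 hα hA hB hBp (negl_commutator_of_sqrt hAB hA) h0 h1.le s)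
    (negl_rpow_sub hα0 hα hA hB hBp hAB h0 h1) m
  have e1 : ((m + 1 : ℕ) : ℝ) * θ = p := by rw [hθ]; field_simp
  have e2 : 1 / p * p = 1 / 1 := by field_simp
  rw [e1, e2] at key
  exact key.symm
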